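/- Let $0<\alpha_1<\alpha_2<1$, $0<\beta<1$, $c>0$, $\lambda>0$, $u_0\in\mathbb R$, and let $$\alpha(t)=\alpha_2+(\alpha_1-\alpha_2)E_\beta(-ct^\beta),\qquad E_\beta(z)=\sum_{k=0}^\infty\frac{z^k}{\Gamma(\beta k+1)},\qquad t\ge 0 .$$ The Scarpi derivative of order $\alpha(t)$ of a locally absolutely continuous function $f$ on $[0,\infty)$ is $D f(t)=\int_0^t\varphi_\alpha(t-\tau)f'(\tau)\,d\tau$, where $\varphi_\alpha$ is the inverse Laplace transform of $s^{s\mathcal L[\alpha](s)-1}$, i.e. the function on $(0,\infty)$ (unique up to null sets) whose Laplace transform converges absolutely and equals $s^{s\mathcal L[\alpha](s)-1}$ on some right half-plane. A solution of the relaxation problem $$D u(t)=-\lambda u(t)\quad(t>0),\qquad u(0)=u_0 \tag{1}$$ is a function $u:[0,\infty)\to\mathbb R$, absolutely continuous on every $[0,T]$, with $u(0)=u_0$, such that for every $t>0$ the integral defining $Du(t)$ converges and equals $-\lambda u(t)$. Put $$A(s)=\frac{\alpha_1s^\beta+\alpha_2c}{s(s^\beta+c)},\qquad G(s)=\frac{s^{sA(s)-1}}{s^{sA(s)}+\lambda},$$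 all powers of $s$ being taken with the principal logarithm for $s\in\mathbb C\setminus(-\infty,0]$ and with the logarithm $\log\rho\pm i\pi$ at the boundary points $s=\rho e^{\pm i\pi}$, $\rho>0$, of the cut plane. Let $P$ be the set of zeros of $s^{sA(s)}+\lambda$ in $\mathbb C\setminus(-\infty,0]$; these are exactly the poles of $G(s)e^{st}$ there. Assume that $s^{sA(s)}+\lambda\ne0$ at $s=\rho e^{i\pi}$ and at $s=\rho e^{-i\pi}$ for every $\rho>0$. Then $\mathcal L[\alpha](s)=A(s)$ on some right half-plane, $P$ is finite, and (1) has a unique solution $u$. Its Laplace transform is $\mathcal L[u](s)=u_0G(s)$ on some right half-plane. For every $t\ge0$ the function $\rho\mapsto\big(G(\rho e^{i\pi})-G(\rho e^{-i\pi})\big)e^{-\rho t}$ is integrable on $(0,\infty)$. Moreover, for every $s_0>0$ that exceeds the real parts of all points of $P$ there are $R_0,\varepsilon_0>0$ such that for all $R\ge R_0$, $0<\varepsilon\le\varepsilon_0$ and $t\ge0$, $$u(t)=\frac{u_0}{2\pi i}\left(\mathfrak R-\int_0^\infty\big(G(\rho e^{i\pi})-G(\rho e^{-i\pi})\big)e^{-\rho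 t}\,d\rho\right),$$ where $\mathfrak R$ is $2\pi i$ times the sum of the residues of $s\mapsto G(s)e^{st}$ at the points of $P$ inside the keyhole contour $\Gamma$. Here $\Gamma$ consists of the segment from $s_0-iR$ to $s_0+iR$, the segments from $s_0\pm iR$ to $\pm iR$, the left half of the circle $|s|=R$, both sides of the cut from $-R$ to $-\varepsilon$, and the circle $|s|=\varepsilon$. Explicitly, $$G(\rho e^{\pm i\pi})=\frac{(\rho e^{\pm i\pi})^{\frac{(\alpha_1-1)(\rho e^{\pm i\pi})^\beta+(\alpha_2-1)c}{(\rho e^{\pm i\pi})^\beta+c}}}{(\rho e^{\pm i\pi})^{\frac{\alpha_1(\rho e^{\pm i\pi})^\beta+\alpha_2c}{(\rho e^{\pm i\pi})^\beta+c}}+\lambda}.$$ -/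

import Mathlib

open Set Filter Topology MeasureTheory

noncomputable section

/-- The Mittag-Leffler function `E_β(x) = ∑ x ^ k / Γ(β k + 1)` of a real variable. -/
def mittagLefflerFun (β x : ℝ) : ℝ :=
  ∑' k : ℕ, x ^ k / Real.Gamma (β * k + 1)

/-- The transition function `α(t) = α₂ + (α₁ - α₂) E_β(-c t ^ β)`, `t ≥ 0`. -/
def mlTransition (α₁ α₂ β c t : ℝ) : ℝ :=
  α₂ + (α₁ - α₂) * mittagLefflerFun β (-c * t ^ β)

/-- The Laplace integral of a real function on `(0, ∞)`. -/
def laplaceIntegral (f : ℝ → ℝ) (s : ℂ) : ℂ :=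
  ∫ t in Ioi (0 : ℝ), Complex.exp (-s * t) * (f t : ℂ)

/-- `F = 𝓛[f]`: the Laplace integral of `f` converges absolutely and equals `F` on some right
half-plane. -/
def HasLaplaceTransform (f : ℝ → ℝ) (F : ℂ → ℂ) : Prop :=
  ∃ σ : ℝ, ∀ s : ℂ, σ < s.re →
    IntegrableOn (fun t : ℝ => Complex.exp (-s * t) * (f t : ℂ)) (Ioi 0) ∧
      laplaceIntegral f s = F s

/-- The inverse Laplace transform: a function on `(0, ∞)` with Laplace transform `F`, if there is
one. It is determined up to a null set. -/
def inverseLaplace (F : ℂ → ℂ) : ℝ → ℝ :=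
  Classical.epsilon fun f => HasLaplaceTransform f F

/-- The kernel `φ_α = 𝓛⁻¹[s ^ (s A(s) - 1)]`, where `A = 𝓛[α]`. -/
def scarpiKernel (α : ℝ → ℝ) : ℝ → ℝ :=
  inverseLaplace fun s => s ^ (s * laplaceIntegral α s - 1)

/-- The Scarpi derivative `(D f)(t) = ∫₀ᵗ φ_α(t - τ) f'(τ) dτ` of variable order `α`. -/
def scarpiDeriv (α f : ℝ → ℝ) (t : ℝ) : ℝ :=
  ∫ τ in (0 : ℝ)..t, scarpiKernel α (t - τ) * deriv f τ

/-- `u` solves the relaxation problem `D u = -λ u` on `(0, ∞)`, `u(0) = u₀`: it is absolutely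
continuous on every `[0, T]`, and for every `t > 0` the convolution defining `(D u)(t)` converges
and equals `-λ u(t)`. Only the values of `u` on `[0, ∞)` matter. -/
structure IsScarpiRelaxationSolution (α : ℝ → ℝ) (lam u₀ : ℝ) (u : ℝ → ℝ) : Prop where
  absolutelyContinuous : ∀ T : ℝ, 0 < T → AbsolutelyContinuousOnInterval u 0 T
  initial : u 0 = u₀
  kernel_integrable : ∀ t : ℝ, 0 < t →
    IntervalIntegrable (fun τ => scarpiKernel α (t - τ) * deriv u τ) volume 0 t
  equation : ∀ t : ℝ, 0 < t → scarpiDeriv α u t = -lam * u t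

/-- The power `s ^ z` for the choice `ℓ` of the logarithm of `s = exp ℓ`. -/
def powLog (ℓ z : ℂ) : ℂ := Complex.exp (z * ℓ)

/-- `A(s) = (α₁ s ^ β + α₂ c) / (s (s ^ β + c))` at the point `s` with logarithm `ℓ`. -/
def mlA (α₁ α₂ β c : ℝ) (ℓ : ℂ) : ℂ :=
  (α₁ * powLog ℓ β + α₂ * c) / (Complex.exp ℓ * (powLog ℓ β + c))

/-- `s ^ (s A(s)) + λ` at the point `s` with logarithm `ℓ`. -/
def relaxDenom (α₁ α₂ β c lam : ℝ) (ℓ : ℂ) : ℂ :=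
  powLog ℓ (Complex.exp ℓ * mlA α₁ α₂ β c ℓ) + lam

/-- `s ^ (s A(s) - 1) / (s ^ (s A(s)) + λ)` at the point `s` with logarithm `ℓ`. -/
def relaxSymbol (α₁ α₂ β c lam : ℝ) (ℓ : ℂ) : ℂ :=
  powLog ℓ (Complex.exp ℓ * mlA α₁ α₂ β c ℓ - 1) / relaxDenom α₁ α₂ β c lam ℓ

/-- Off the origin, with the principal logarithm, `powLog` is the usual complex power. -/
theorem powLog_log {s : ℂ} (hs : s ≠ 0) (z : ℂ) : powLog (Complex.log s) z = s ^ z := by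
  rw [powLog, Complex.cpow_def_of_ne_zero hs, mul_comm]

/-- With the principal logarithm `mlA` is the usual closed form of `A`. -/
theorem mlA_log {s : ℂ} (hs : s ≠ 0) (α₁ α₂ β c : ℝ) :
    mlA α₁ α₂ β c (Complex.log s) =
      (α₁ * s ^ (β : ℂ) + α₂ * c) / (s * (s ^ (β : ℂ) + c)) := by
  rw [mlA, powLog_log hs, Complex.exp_log hs]

/-- The upper (`σ = 1`) and lower (`σ = -1`) logarithm `log ρ + σ i π` of `-ρ`. -/
def cutLog (σ ρ : ℝ) : ℂ := (Real.log ρ : ℂ) + σ * Real.pi * Complex.I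

/-- The poles of `s ↦ s ^ (s A(s) - 1) / (s ^ (s A(s)) + λ) e ^ (s t)` in the plane cut along
`(-∞, 0]`: the numerator has no zeros there, so these are the zeros of `s ^ (s A(s)) + λ`. -/
def relaxPoles (α₁ α₂ β c lam : ℝ) : Set ℂ :=
  {s | s ∈ Complex.slitPlane ∧ relaxDenom α₁ α₂ β c lam (Complex.log s) = 0}

/-- The residue of `f` at an isolated singularity `z`: the value for all small `r > 0` of
`(2 π i)⁻¹` times the integral of `f` over the circle with centre `z` and radius `r`. -/
def cresidue (f : ℂ → ℂ) (z : ℂ) : ℂ :=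
  limUnder (𝓝[>] (0 : ℝ)) fun r => (2 * Real.pi * Complex.I)⁻¹ * ∮ w in C(z, r), f w

/-- The region enclosed by the keyhole contour `Γ`: it is bounded by the segment from `s₀ - i R` to
`s₀ + i R`, the segments from `s₀ ± i R` to `± i R`, the left half of the circle `|s| = R`, both
sides of the cut from `-R` to `-ε`, and the circle `|s| = ε`. -/
def contourInterior (s₀ R ε : ℝ) : Set ℂ :=
  {s | s ∈ Complex.slitPlane ∧ ε < ‖s‖ ∧ (s.re ≤ 0 → ‖s‖ < R) ∧
    (0 < s.re → s.re < s₀ ∧ |s.im| < R)}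

/-- `2 π i` times the sum of the residues of `s ^ (s A(s) - 1) / (s ^ (s A(s)) + λ) e ^ (s t)`
at its poles inside `Γ`. -/
def residueTerm (α₁ α₂ β c lam s₀ R ε t : ℝ) : ℂ :=
  2 * Real.pi * Complex.I *
    ∑ᶠ z ∈ relaxPoles α₁ α₂ β c lam ∩ contourInterior s₀ R ε,
      cresidue (fun s => relaxSymbol α₁ α₂ β c lam (Complex.log s) * Complex.exp (s * t)) z

/-- The difference of the values at `s = ρ e ^ (i π)` and `s = ρ e ^ (-i π)` of
`s ^ (s A(s) - 1) / (s ^ (s A(s)) + λ) e ^ (s t)`. -/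
def cutIntegrand (α₁ α₂ β c lam t ρ : ℝ) : ℂ :=
  (relaxSymbol α₁ α₂ β c lam (cutLog 1 ρ) - relaxSymbol α₁ α₂ β c lam (cutLog (-1) ρ)) *
    Complex.exp (-ρ * t)

end

/-!
The Laplace transform turns the problem into algebra. With `a(s) = s A(s)` the Scarpi kernel `φ` has
transform `s ^ (a(s) - 1)`. Let `r` have transform `1 / (s ^ a(s) + λ)`; then `(φ + λ) * r = 1`, and
`u = u₀ (1 - λ ∫₀ᵗ r)` is absolutely continuous, satisfies `φ * u' = -λ u₀ (φ * r) = -λ u`, and has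
transform `u₀ G`. Conversely, convolving the equation of any solution with `r` gives back this
formula; this uses the equation on a bounded interval only, so that no growth of the solution has to
be assumed (`IsResolvent.solution_unique`). The pointwise statements follow from those between
transforms because the functions involved are continuous on `(0, ∞)` with integrable power
singularities at `0` (`IsWeaklySingular`), and a Laplace transform determines a function almost
everywhere (`HasComplexLaplace.ae_eq`).

What remains is to invert three explicit transforms: those of `φ`, `r` and `u`. No Bromwich integral
is needed. In the coordinate `ζ = log s` the closed cut plane is the strip `|Im ζ| ≤ π`, the keyhole
contour becomes a rectangle, and the symbols are given by formulas valid on the whole closed strip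
(`IsStripSymbol`). Subtracting the principal parts at the finitely many poles and applying Cauchy's
theorem on `[-N, N] × [-π, π]` shows that a symbol `h` is the sum of its principal parts and of the
Stieltjes transform of its jump across the cut (`IsStripSymbol.eq_stieltjes`,
`IsStripSymbol.exists_decomposition`). Both kinds of summands are visibly Laplace transforms: of
`t ^ j / j! * exp (p t)`, which together make up the residues of `h(log s) e ^ (s t)`, and of
`∫ jump(ρ) e ^ (-ρ t) dρ`. For `h = G` this is the asserted representation of `u`; it holds up to
`t = 0` because the jump of `G` is integrable (`integrableOn_cutJump_relaxSymbol`).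

The growth conditions rest on one estimate: `s ^ β` keeps away from `-c` in the closed cut plane since
`β < 1`, so `(a(s) - α₁) log s` is bounded for `|s| ≥ 1` and `(a(s) - α₂) log s` for `|s| ≤ 1`
(`exists_bound_mlOrder`). It also confines the zeros of `s ^ a(s) + λ` to a compact part of the
strip, so there are finitely many.
-/

noncomputable section

/-! ### Complex-valued Laplace transforms -/

/-- An integrable real function whose Fourier transform vanishes is zero almost everywhere:
its positive and negative parts define finite measures with the same characteristic function. -/
theorem ae_eq_zero_of_forall_integral_exp_mul_eq_zero {μ : Measure ℝ} {g : ℝ → ℝ}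
    (hg : Integrable g μ)
    (h : ∀ ξ : ℝ, ∫ x, Complex.exp (ξ * x * Complex.I) * (g x : ℂ) ∂μ = 0) : g =ᵐ[μ] 0 := by
  have hm : AEMeasurable (fun x => ENNReal.ofReal (g x)) μ := hg.aemeasurable.ennreal_ofReal
  have hm' : AEMeasurable (fun x => ENNReal.ofReal (-g x)) μ := hg.neg.aemeasurable.ennreal_ofReal
  have : IsFiniteMeasure (μ.withDensity fun x => ENNReal.ofReal (g x)) :=
    isFiniteMeasure_withDensity_ofReal hg.hasFiniteIntegral
  have : IsFiniteMeasure (μ.withDensity fun x => ENNReal.ofReal (-g x)) :=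
    isFiniteMeasure_withDensity_ofReal hg.neg.hasFiniteIntegral
  have hint : ∀ (ξ : ℝ) (k : ℝ → ℝ), Integrable k μ →
      Integrable (fun x => k x • Complex.exp (ξ * x * Complex.I)) μ := by
    intro ξ k hk
    have : (fun x => k x • Complex.exp (ξ * x * Complex.I))
        = fun x : ℝ => Complex.exp (ξ * x * Complex.I) * (k x : ℂ) := by
      ext x; simp [mul_comm]
    rw [this]
    refine hk.ofReal.bdd_mul (c := 1) (by fun_prop) (ae_of_all _ fun x => ?_)
    rw [← Complex.ofReal_mul, Complex.norm_exp_ofReal_mul_I]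
  have key : μ.withDensity (fun x => ENNReal.ofReal (g x))
      = μ.withDensity fun x => ENNReal.ofReal (-g x) := by
    refine Measure.ext_of_charFun (funext fun ξ => ?_)
    rw [charFun_apply_real, charFun_apply_real,
      integral_withDensity_eq_integral_toReal_smul₀ hm (by simp),
      integral_withDensity_eq_integral_toReal_smul₀ hm' (by simp), ← sub_eq_zero,
      ← integral_sub, ← h ξ]
    · refine integral_congr_ae (ae_of_all _ fun x => ?_)
      simp only [ENNReal.toReal_ofReal', ← sub_smul]
      rw [Complex.real_smul, mul_comm]
      congr 2
      rcases le_total 0 (g x) with h0 | h0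
      · rw [max_eq_left h0, max_eq_right (by linarith)]; ring
      · rw [max_eq_right h0, max_eq_left (by linarith)]; ring
    · simp only [ENNReal.toReal_ofReal']
      exact hint ξ _ hg.pos_part
    · simp only [ENNReal.toReal_ofReal']
      exact hint ξ _ hg.neg_part
  have h2 := (withDensity_eq_iff hm hm'
    (by
      have := hg.lintegral_lt_top
      exact this.ne)).1 key
  filter_upwards [h2] with x hx
  rcases le_total 0 (g x) with h0 | h0
  · rw [ENNReal.ofReal_of_nonpos (by linarith : -g x ≤ 0)] at hx
    exact le_antisymm (ENNReal.ofReal_eq_zero.1 hx) h0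
  · rw [ENNReal.ofReal_of_nonpos h0] at hx
    have := ENNReal.ofReal_eq_zero.1 hx.symm
    simp only [Pi.zero_apply]
    linarith

/-- `F = 𝓛[f]` for a complex-valued function `f`: the Laplace integral of `f` converges absolutely
and equals `F` on some right half-plane. For `f = fun t => (g t : ℂ)` with `g` real this is
`HasLaplaceTransform g F` by definition. -/
def HasComplexLaplace (f : ℝ → ℂ) (F : ℂ → ℂ) : Prop :=
  ∃ σ : ℝ, ∀ s : ℂ, σ < s.re →
    IntegrableOn (fun t : ℝ => Complex.exp (-s * t) * f t) (Ioi 0) ∧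
      ∫ t in Ioi (0 : ℝ), Complex.exp (-s * t) * f t = F s

namespace HasComplexLaplace

variable {f g : ℝ → ℂ} {F G : ℂ → ℂ}

theorem congr_transform (h : HasComplexLaplace f F) (σ : ℝ)
    (hFG : ∀ s : ℂ, σ < s.re → F s = G s) : HasComplexLaplace f G := by
  obtain ⟨τ, hτ⟩ := h
  refine ⟨max σ τ, fun s hs => ?_⟩
  rw [max_lt_iff] at hs
  exact ⟨(hτ s hs.2).1, (hτ s hs.2).2.trans (hFG s hs.1)⟩

theorem congr_ae (h : HasComplexLaplace f F) (hfg : f =ᵐ[volume.restrict (Ioi 0)] g) :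
    HasComplexLaplace g F := by
  obtain ⟨τ, hτ⟩ := h
  refine ⟨τ, fun s hs => ?_⟩
  have : (fun t : ℝ => Complex.exp (-s * t) * f t) =ᵐ[volume.restrict (Ioi 0)]
      fun t : ℝ => Complex.exp (-s * t) * g t := by
    filter_upwards [hfg] with t ht
    rw [ht]
  exact ⟨(hτ s hs).1.congr this, by rw [← (hτ s hs).2, integral_congr_ae this]⟩

theorem add (hf : HasComplexLaplace f F) (hg : HasComplexLaplace g G) :
    HasComplexLaplace (fun t => f t + g t) (fun s => F s + G s) := by
  obtain ⟨σ, hσ⟩ := hf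
  obtain ⟨τ, hτ⟩ := hg
  refine ⟨max σ τ, fun s hs => ?_⟩
  rw [max_lt_iff] at hs
  obtain ⟨a1, a2⟩ := hσ s hs.1
  obtain ⟨b1, b2⟩ := hτ s hs.2
  simp only [mul_add]
  exact ⟨a1.add b1, by rw [integral_add a1 b1, a2, b2]⟩

theorem const_mul (c : ℂ) (hf : HasComplexLaplace f F) :
    HasComplexLaplace (fun t => c * f t) (fun s => c * F s) := by
  obtain ⟨σ, hσ⟩ := hf
  refine ⟨σ, fun s hs => ?_⟩
  obtain ⟨a1, a2⟩ := hσ s hs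
  simp only [mul_left_comm _ c]
  exact ⟨a1.const_mul c, by rw [integral_const_mul, a2]⟩

theorem zero : HasComplexLaplace (fun _ => 0) (fun _ => 0) :=
  ⟨0, fun s _ => by simp⟩

theorem sum {ι : Type*} (S : Finset ι) {f : ι → ℝ → ℂ} {F : ι → ℂ → ℂ}
    (h : ∀ i ∈ S, HasComplexLaplace (f i) (F i)) :
    HasComplexLaplace (fun t => ∑ i ∈ S, f i t) (fun s => ∑ i ∈ S, F i s) := by
  classical
  induction S using Finset.induction_on with
  | empty => simpa using zero
  | insert a S ha ih =>
    simp only [Finset.sum_insert ha]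
    exact (h a (by simp)).add (ih fun i hi => h i (by simp [hi]))

theorem conj (hf : HasComplexLaplace f F) :
    HasComplexLaplace (fun t => (starRingEnd ℂ) (f t))
      (fun s => (starRingEnd ℂ) (F ((starRingEnd ℂ) s))) := by
  obtain ⟨σ, hσ⟩ := hf
  refine ⟨σ, fun s hs => ?_⟩
  obtain ⟨a1, a2⟩ := hσ ((starRingEnd ℂ) s) (by simpa using hs)
  have e : (fun t : ℝ => Complex.exp (-s * t) * (starRingEnd ℂ) (f t))
      = fun t : ℝ => (starRingEnd ℂ) (Complex.exp (-(starRingEnd ℂ) s * t) * f t) := by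
    ext t
    rw [map_mul, ← Complex.exp_conj]
    simp
  rw [e]
  refine ⟨?_, ?_⟩
  · exact (LinearIsometryEquiv.integrable_comp_iff Complex.conjLIE).2 a1
  · rw [integral_conj, a2]

/-- A function whose transform commutes with conjugation may be replaced by its real part. -/
theorem re (hf : HasComplexLaplace f F)
    (hF : ∃ σ : ℝ, ∀ s : ℂ, σ < s.re → F ((starRingEnd ℂ) s) = (starRingEnd ℂ) (F s)) :
    HasComplexLaplace (fun t => ((f t).re : ℂ)) F := by
  obtain ⟨σ, hσ⟩ := hF
  have h := ((hf.add hf.conj).const_mul (1 / 2)).congr_transform (G := F) σ (fun s hs => by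
    rw [hσ s hs, Complex.conj_conj]; ring)
  convert! h using 2 with t
  rw [Complex.add_conj]
  push_cast
  ring

theorem ae_eq_zero_of_real {f : ℝ → ℝ} (hf : HasComplexLaplace (fun t => (f t : ℂ)) fun _ => 0) :
    f =ᵐ[volume.restrict (Ioi 0)] 0 := by
  obtain ⟨σ, hσ⟩ := hf
  have hexp : ∀ (ξ t : ℝ), Complex.exp (-((σ + 1 : ℝ) - ξ * Complex.I) * t) * (f t : ℂ)
      = Complex.exp (ξ * t * Complex.I) * ((Real.exp (-(σ + 1) * t) * f t : ℝ) : ℂ) := by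
    intro ξ t
    push_cast
    rw [← mul_assoc, ← Complex.exp_add]
    congr 2
    ring
  have h1 : Integrable (fun t => Real.exp (-(σ + 1) * t) * f t) (volume.restrict (Ioi 0)) := by
    have := (hσ ((σ + 1 : ℝ) - (0 : ℝ) * Complex.I) (by simp)).1
    simp only [hexp] at this
    have h2 := this.re
    simpa [← Complex.ofReal_mul, ← Complex.ofReal_exp] using h2
  have h2 := ae_eq_zero_of_forall_integral_exp_mul_eq_zero h1 fun ξ => by
    have := (hσ ((σ + 1 : ℝ) - ξ * Complex.I) (by simp)).2
    simpa only [hexp] using this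
  filter_upwards [h2] with t ht
  simpa using ht

/-- A function is determined almost everywhere by its Laplace transform. -/
theorem ae_eq (hf : HasComplexLaplace f F) (hg : HasComplexLaplace g F) :
    f =ᵐ[volume.restrict (Ioi 0)] g := by
  have h0 : HasComplexLaplace (fun t => f t - g t) fun _ => 0 := by
    have := (hf.add (hg.const_mul (-1))).congr_transform (G := fun _ => 0) 0 (fun s _ => by ring)
    simpa [← sub_eq_add_neg] using this
  have h1 := (h0.re ⟨0, fun s _ => by simp⟩).ae_eq_zero_of_real
  have h2 := ((h0.const_mul (-Complex.I)).re ⟨0, fun s _ => by simp⟩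
    |>.congr_transform (G := fun _ => 0) 0 (fun s _ => by simp)).ae_eq_zero_of_real
  filter_upwards [h1, h2] with t ht1 ht2
  apply Complex.ext
  · simpa [sub_eq_zero] using ht1
  · simpa [sub_eq_zero] using ht2

/-- Two functions with the same transform that are continuous on `(0, ∞)` agree there. -/
theorem eqOn (hf : HasComplexLaplace f F) (hg : HasComplexLaplace g F)
    (hf' : ContinuousOn f (Ioi 0)) (hg' : ContinuousOn g (Ioi 0)) : EqOn f g (Ioi 0) :=
  Measure.eqOn_open_of_ae_eq (hf.ae_eq hg) isOpen_Ioi hf' hg'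

/-- The convolution theorem for the Laplace transform. -/
theorem convolution (hf : HasComplexLaplace f F) (hg : HasComplexLaplace g G) :
    HasComplexLaplace (fun t => ∫ τ in (0 : ℝ)..t, f τ * g (t - τ)) (fun s => F s * G s) := by
  obtain ⟨σ, hσ⟩ := hf
  obtain ⟨τ, hτ⟩ := hg
  refine ⟨max σ τ, fun s hs => ?_⟩
  rw [max_lt_iff] at hs
  obtain ⟨a1, a2⟩ := hσ s hs.1
  obtain ⟨b1, b2⟩ := hτ s hs.2
  -- `e ^ (-s t)` is absorbed into the two factors
  have e : (fun t : ℝ => Complex.exp (-s * t) * ∫ τ in (0 : ℝ)..t, f τ * g (t - τ))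
      = fun t : ℝ => ∫ τ in (0 : ℝ)..t, ContinuousLinearMap.mul ℝ ℂ
        (Complex.exp (-s * τ) * f τ) (Complex.exp (-s * ((t - τ : ℝ) : ℂ)) * g (t - τ)) := by
    ext t
    rw [← intervalIntegral.integral_const_mul]
    refine intervalIntegral.integral_congr fun x _ => ?_
    simp only [ContinuousLinearMap.mul_apply']
    rw [mul_mul_mul_comm, ← Complex.exp_add]
    congr 2
    push_cast
    ring
  rw [e]
  constructor
  · have := integrable_posConvolution a1 b1 (ContinuousLinearMap.mul ℝ ℂ)
    exact (this.integrableOn (s := Ioi 0)).congr_fun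
      (fun t ht => by simp [posConvolution, indicator_of_mem ht]) measurableSet_Ioi
  · rw [integral_posConvolution a1 b1 (ContinuousLinearMap.mul ℝ ℂ), a2, b2]
    simp

theorem exp_mul (p : ℂ) : HasComplexLaplace (fun t => Complex.exp (p * t)) (fun s => (s - p)⁻¹) := by
  refine ⟨p.re, fun s hs => ?_⟩
  have hr : (p - s).re < 0 := by simpa using hs
  have e : (fun t : ℝ => Complex.exp (-s * t) * Complex.exp (p * t))
      = fun t : ℝ => Complex.exp ((p - s) * t) := by
    ext t
    rw [← Complex.exp_add]
    ring_nf
  rw [e]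
  refine ⟨integrableOn_exp_mul_complex_Ioi hr 0, ?_⟩
  rw [integral_exp_mul_complex_Ioi hr 0]
  simp only [Complex.ofReal_zero, mul_zero, Complex.exp_zero]
  rw [← neg_sub s p, neg_div_neg_eq, one_div]

/-- The transform of `t ^ j / j! * exp (p t)` is `(s - p) ^ (-(j + 1))`; each further factor
`(s - p)⁻¹` is a convolution with `exp (p t)`. -/
theorem pow_mul_exp (p : ℂ) (j : ℕ) :
    HasComplexLaplace (fun t => (t : ℂ) ^ j / j.factorial * Complex.exp (p * t))
      (fun s => ((s - p) ^ (j + 1))⁻¹) := by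
  induction j with
  | zero => simpa using exp_mul p
  | succ j ih =>
    have h := (ih.convolution (exp_mul p)).congr_transform (G := fun s => ((s - p) ^ (j + 2))⁻¹) 0
      (fun s _ => by rw [pow_succ _ (j + 1), mul_inv])
    convert h using 2 with t
    have e : ∀ τ : ℝ, (τ : ℂ) ^ j / j.factorial * Complex.exp (p * τ)
        * Complex.exp (p * ((t - τ : ℝ) : ℂ))
          = ((τ ^ j : ℝ) : ℂ) * (Complex.exp (p * t) / j.factorial) := by
      intro τ
      have : Complex.exp (p * t) = Complex.exp (p * τ) * Complex.exp (p * ((t - τ : ℝ) : ℂ)) := by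
        rw [← Complex.exp_add]
        congr 1
        push_cast
        ring
      rw [this]
      push_cast
      ring
    simp only [e]
    rw [intervalIntegral.integral_mul_const, intervalIntegral.integral_ofReal, integral_pow,
      Nat.factorial_succ]
    have h1 : (j.factorial : ℂ) ≠ 0 := by exact_mod_cast j.factorial_ne_zero
    have h2 : (j : ℂ) + 1 ≠ 0 := by exact_mod_cast j.succ_ne_zero
    push_cast
    field_simp
    simp

theorem one : HasComplexLaplace (fun _ => 1) (fun s => s⁻¹) := by
  simpa using pow_mul_exp 0 0

theorem primitive (hf : HasComplexLaplace f F) :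
    HasComplexLaplace (fun t => ∫ τ in (0 : ℝ)..t, f τ) (fun s => F s * s⁻¹) := by
  simpa using hf.convolution one

/-- Where the Laplace integral converges absolutely, it is a holomorphic function. -/
theorem _root_.differentiableOn_laplace {f : ℝ → ℂ} {σ : ℝ}
    (h : ∀ s : ℂ, σ < s.re → IntegrableOn (fun t : ℝ => Complex.exp (-s * t) * f t) (Ioi 0)) :
    DifferentiableOn ℂ (fun s => ∫ t in Ioi (0 : ℝ), Complex.exp (-s * t) * f t)
      {s | σ < s.re} := by
  intro s hs
  refine DifferentiableAt.differentiableWithinAt ?_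
  have hs' : σ < s.re := hs
  obtain ⟨δ, hδ, hδs⟩ : ∃ δ > 0, σ + 3 * δ < s.re :=
    ⟨(s.re - σ) / 4, by linarith, by linarith⟩
  -- on the ball of radius `δ` the factor `t` of the derivative costs a decay of `e ^ (-δ t)`
  have hint := h ((σ + δ : ℝ) : ℂ) (by simp [hδ])
  have hmeas : ∀ z : ℂ, AEStronglyMeasurable (fun t : ℝ => Complex.exp (-z * t) * f t)
      (volume.restrict (Ioi 0)) := by
    intro z
    have : (fun t : ℝ => Complex.exp (-z * t) * f t) = fun t : ℝ =>
        Complex.exp ((((σ + δ : ℝ) : ℂ) - z) * t)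
          * (Complex.exp (-((σ + δ : ℝ) : ℂ) * t) * f t) := by
      ext t
      rw [← mul_assoc, ← Complex.exp_add]
      congr 2
      ring
    rw [this]
    exact AEStronglyMeasurable.mul (by fun_prop) hint.aestronglyMeasurable
  refine (hasDerivAt_integral_of_dominated_loc_of_deriv_le
    (F' := fun (z : ℂ) (t : ℝ) => -(t : ℂ) * (Complex.exp (-z * t) * f t))
    (bound := fun t : ℝ => δ⁻¹ * ‖Complex.exp (-((σ + δ : ℝ) : ℂ) * t) * f t‖)
    (Metric.ball_mem_nhds s hδ) (Eventually.of_forall hmeas) (h s hs)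
    (AEStronglyMeasurable.mul (by fun_prop) (hmeas s)) ?_ (hint.norm.const_mul _) ?_).2.differentiableAt
  · filter_upwards [ae_restrict_mem measurableSet_Ioi] with t ht z hz
    have ht0 : (0 : ℝ) < t := ht
    have hz' : σ + 2 * δ ≤ z.re := by
      have h1 := (Complex.abs_re_le_norm (z - s)).trans_lt (by simpa [dist_eq_norm] using hz)
      rw [Complex.sub_re, abs_lt] at h1
      linarith [h1.1]
    rw [norm_mul, norm_mul, norm_mul, norm_neg, Complex.norm_real, Real.norm_of_nonneg ht0.le,
      ← mul_assoc, ← mul_assoc]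
    refine mul_le_mul_of_nonneg_right ?_ (norm_nonneg _)
    rw [Complex.norm_exp, Complex.norm_exp]
    have e1 : (-z * (t : ℂ)).re = -z.re * t := by simp
    have e2 : (-((σ + δ : ℝ) : ℂ) * (t : ℂ)).re = -(σ + δ) * t := by simp
    rw [e1, e2]
    have e3 : t ≤ δ⁻¹ * Real.exp (δ * t) := by
      have := Real.add_one_le_exp (δ * t)
      rw [inv_mul_eq_div, le_div_iff₀ hδ]
      linarith
    calc t * Real.exp (-z.re * t) ≤ δ⁻¹ * Real.exp (δ * t) * Real.exp (-(σ + 2 * δ) * t) := by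
          gcongr
        _ = δ⁻¹ * Real.exp (-(σ + δ) * t) := by
          rw [mul_assoc, ← Real.exp_add]
          ring_nf
  · refine ae_of_all _ fun t z _ => ?_
    have h1 : HasDerivAt (fun z : ℂ => -z * t) (-(t : ℂ)) z := by
      simpa using ((hasDerivAt_id z).neg.mul_const (t : ℂ))
    exact (h1.cexp.mul_const (f t)).congr_deriv (by ring)

/-- The Laplace transform of a Laplace transform is a Stieltjes transform. -/
theorem stieltjes {k : ℝ → ℂ} (hk : IntegrableOn (fun ρ => k ρ / (1 + ρ : ℝ)) (Ioi 0)) :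
    HasComplexLaplace (fun t => ∫ ρ in Ioi (0 : ℝ), k ρ * Complex.exp (-ρ * t))
      (fun s => ∫ ρ in Ioi (0 : ℝ), k ρ / (ρ + s)) := by
  refine ⟨1, fun s hs => ?_⟩
  have hm : AEStronglyMeasurable k (volume.restrict (Ioi 0)) := by
    have := hk.aestronglyMeasurable.mul
      (g := fun ρ : ℝ => ((1 + ρ : ℝ) : ℂ)) (by fun_prop)
    refine this.congr ?_
    filter_upwards [ae_restrict_mem measurableSet_Ioi] with ρ hρ
    have : ((1 + ρ : ℝ) : ℂ) ≠ 0 := by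
      have : (0 : ℝ) < ρ := hρ
      exact_mod_cast (by positivity : (1 + ρ : ℝ) ≠ 0)
    simp only [Pi.mul_apply]
    field_simp
  have hexp : ∀ t ρ : ℝ, Complex.exp (-s * t) * (k ρ * Complex.exp (-ρ * t))
      = k ρ * Complex.exp (-(ρ + s) * t) := by
    intro t ρ
    rw [mul_left_comm, ← Complex.exp_add]
    ring_nf
  have hInt : Integrable (Function.uncurry fun (t ρ : ℝ) => k ρ * Complex.exp (-(ρ + s) * t))
      ((volume.restrict (Ioi 0)).prod (volume.restrict (Ioi 0))) := by
    have hmeas : AEStronglyMeasurable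
        (Function.uncurry fun (t ρ : ℝ) => k ρ * Complex.exp (-(ρ + s) * t))
        ((volume.restrict (Ioi 0)).prod (volume.restrict (Ioi 0))) := by
      simp only [Function.uncurry_def]
      exact hm.comp_snd.mul (by fun_prop)
    rw [integrable_prod_iff' hmeas]
    have hneg : ∀ ρ ∈ Ioi (0 : ℝ), (-((ρ : ℂ) + s)).re < 0 := by
      intro ρ hρ
      have : (0 : ℝ) < ρ := hρ
      simp only [Complex.neg_re, Complex.add_re, Complex.ofReal_re]
      linarith
    constructor
    · filter_upwards [ae_restrict_mem measurableSet_Ioi] with ρ hρ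
      exact (integrableOn_exp_mul_complex_Ioi (hneg ρ hρ) 0).const_mul (k ρ)
    · refine Integrable.mono' hk.norm ?_ ?_
      · exact hmeas.norm.prod_swap.integral_prod_right'
      · filter_upwards [ae_restrict_mem measurableSet_Ioi] with ρ hρ
        have hρ' : (0 : ℝ) < ρ := hρ
        simp only [Function.uncurry_apply_pair, norm_mul, Complex.norm_exp]
        rw [integral_const_mul]
        have e : ∀ t : ℝ, (-((ρ : ℂ) + s) * t).re = -(ρ + s.re) * t := by
          intro t; simp
        simp only [e]
        rw [integral_exp_mul_Ioi (by linarith : -(ρ + s.re) < 0) 0, norm_mul, norm_norm, norm_div,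
          norm_div, Complex.norm_real, Real.norm_of_nonneg (by positivity : 0 ≤ 1 + ρ)]
        simp only [mul_zero, Real.exp_zero, norm_neg, norm_one]
        rw [Real.norm_of_nonneg (by linarith : 0 ≤ ρ + s.re), mul_one_div]
        refine div_le_div_of_nonneg_left (norm_nonneg _) (by positivity) (by linarith)
  constructor
  · have := hInt.integral_prod_left
    refine (this.congr (ae_of_all _ fun t => ?_))
    simp only [Function.uncurry_apply_pair]
    rw [← integral_const_mul]
    simp only [hexp]
  · have e1 : ∀ t : ℝ, Complex.exp (-s * t) * ∫ ρ in Ioi (0 : ℝ), k ρ * Complex.exp (-ρ * t)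
        = ∫ ρ in Ioi (0 : ℝ), k ρ * Complex.exp (-(ρ + s) * t) := by
      intro t
      rw [← integral_const_mul]
      simp only [hexp]
    simp only [e1]
    rw [integral_integral_swap hInt]
    refine setIntegral_congr_fun measurableSet_Ioi fun ρ hρ => ?_
    have hρ' : (0 : ℝ) < ρ := hρ
    rw [integral_const_mul, integral_exp_mul_complex_Ioi (by simp; linarith) 0]
    simp only [Complex.ofReal_zero, mul_zero, Complex.exp_zero, neg_div_neg_eq, mul_one_div]

end HasComplexLaplace

/-! ### Principal parts and residues -/

/-- Division of an analytic function by `(s - p) ^ n`, with remainder: the principal part has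
the coefficients `c j` at `(s - p) ^ (-(j + 1))`, `j < n`. -/
theorem AnalyticAt.exists_principalPart {p : ℂ} (n : ℕ) :
    ∀ {F : ℂ → ℂ}, AnalyticAt ℂ F p → ∃ (c : ℕ → ℂ) (E : ℂ → ℂ), AnalyticAt ℂ E p ∧
      ∀ s ≠ p, F s / (s - p) ^ n = ∑ j ∈ Finset.range n, c j * ((s - p) ^ (j + 1))⁻¹ + E s := by
  induction n with
  | zero => exact fun {F} hF => ⟨0, F, hF, by simp⟩
  | succ n ih =>
    intro F hF
    obtain ⟨q, hq⟩ := hF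
    obtain ⟨c, E, hE, h⟩ := ih ⟨_, hq.has_fpower_series_dslope_fslope⟩
    refine ⟨fun j => if j = n then F p else c j, E, hE, fun s hs => ?_⟩
    have hs' : s - p ≠ 0 := sub_ne_zero.2 hs
    have h1 : ∑ j ∈ Finset.range n, (if j = n then F p else c j) * ((s - p) ^ (j + 1))⁻¹
        = ∑ j ∈ Finset.range n, c j * ((s - p) ^ (j + 1))⁻¹ :=
      Finset.sum_congr rfl fun j hj => by rw [if_neg (Finset.mem_range.1 hj).ne]
    simp only [Finset.sum_range_succ, if_true]
    rw [h1, add_right_comm, ← h s hs, dslope_of_ne _ hs,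
      slope_def_field]
    field_simp
    ring

/-- The principal part of a meromorphic function at `p`. -/
theorem MeromorphicAt.exists_principalPart {f : ℂ → ℂ} {p : ℂ} (hf : MeromorphicAt f p) :
    ∃ (n : ℕ) (c : ℕ → ℂ) (E : ℂ → ℂ), AnalyticAt ℂ E p ∧
      ∀ s ≠ p, f s = ∑ j ∈ Finset.range n, c j * ((s - p) ^ (j + 1))⁻¹ + E s := by
  obtain ⟨n, hn⟩ := hf
  obtain ⟨c, E, hE, h⟩ := hn.exists_principalPart n
  refine ⟨n, c, E, hE, fun s hs => ?_⟩
  have hs' : s - p ≠ 0 := sub_ne_zero.2 hs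
  rw [← h s hs, smul_eq_mul, mul_div_cancel_left₀ _ (pow_ne_zero n hs')]

/-- The residue of `f(s) e ^ (s t)` in terms of the principal part of `f`. -/
theorem cresidue_mul_exp {f E : ℂ → ℂ} {p : ℂ} {n : ℕ} {c : ℕ → ℂ} (hE : AnalyticAt ℂ E p)
    (h : ∀ s ≠ p, f s = ∑ j ∈ Finset.range n, c j * ((s - p) ^ (j + 1))⁻¹ + E s) (t : ℂ) :
    cresidue (fun s => f s * Complex.exp (s * t)) p
      = ∑ j ∈ Finset.range n, c j * (t ^ j / j.factorial * Complex.exp (p * t)) := by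
  refine Tendsto.limUnder_eq (tendsto_const_nhds.congr' ?_)
  obtain ⟨r₀, hr₀, hball⟩ := Metric.eventually_nhds_iff_ball.1 hE.eventually_analyticAt
  filter_upwards [Ioo_mem_nhdsGT hr₀] with r hr
  have hEd : DifferentiableOn ℂ (fun s => E s * Complex.exp (s * t)) (Metric.closedBall p r) :=
    fun s hs => (((hball s (Metric.closedBall_subset_ball hr.2 hs)).differentiableAt).mul
      (by fun_prop)).differentiableWithinAt
  have hE0 : ∮ s in C(p, r), E s * Complex.exp (s * t) = 0 :=
    Complex.circleIntegral_eq_zero_of_differentiable_on_off_countable hr.1.le countable_empty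
      hEd.continuousOn fun s hs => hEd.differentiableAt
        (mem_of_superset (Metric.isOpen_ball.mem_nhds hs.1) Metric.ball_subset_closedBall)
  have hder : ∀ j : ℕ, iteratedDeriv j (fun s : ℂ => Complex.exp (s * t)) p
      = t ^ j * Complex.exp (p * t) := by
    intro j
    simp [mul_comm _ t]
  have hj : ∀ j : ℕ, ∮ s in C(p, r), c j * (((s - p) ^ (j + 1))⁻¹ * Complex.exp (s * t))
      = 2 * Real.pi * Complex.I * (c j * (t ^ j / j.factorial * Complex.exp (p * t))) := by
    intro j
    have h1 := DifferentiableOn.circleIntegral_one_div_sub_center_pow_smul (c := p) hr.1 j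
      (f := fun s => Complex.exp (s * t)) (by fun_prop)
    rw [hder] at h1
    simp only [one_div, smul_eq_mul] at h1
    rw [circleIntegral.integral_const_mul, h1]
    ring
  have hci : ∀ j : ℕ, CircleIntegrable
      (fun s => c j * (((s - p) ^ (j + 1))⁻¹ * Complex.exp (s * t))) p r := by
    intro j
    refine ContinuousOn.circleIntegrable hr.1.le fun s hs => ContinuousAt.continuousWithinAt ?_
    have : s - p ≠ 0 := by
      intro h0
      rw [mem_sphere_iff_norm, h0, norm_zero] at hs
      exact hr.1.ne hs
    have : (s - p) ^ (j + 1) ≠ 0 := pow_ne_zero _ this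
    fun_prop (disch := assumption)
  have hsum : ∮ s in C(p, r), f s * Complex.exp (s * t)
      = ∮ s in C(p, r), ((∑ j ∈ Finset.range n,
        c j * (((s - p) ^ (j + 1))⁻¹ * Complex.exp (s * t))) + E s * Complex.exp (s * t)) := by
    refine circleIntegral.integral_congr hr.1.le fun s hs => ?_
    have hsp : s ≠ p := by
      rintro rfl
      rw [mem_sphere_iff_norm, sub_self, norm_zero] at hs
      exact hr.1.ne hs
    rw [h s hsp, add_mul, Finset.sum_mul]
    simp only [mul_assoc]
  rw [hsum, circleIntegral.integral_add, circleIntegral.integral_fun_sum, hE0, add_zero]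
  · simp only [hj]
    rw [← Finset.mul_sum, ← mul_assoc, inv_mul_cancel₀, one_mul]
    simp [Real.pi_ne_zero]
  · exact fun j _ => hci j
  · exact CircleIntegrable.fun_sum _ fun j _ => hci j
  · exact (hEd.continuousOn.mono Metric.sphere_subset_closedBall).circleIntegrable hr.1.le

/-! ### Functions on the closed cut plane -/

theorem exp_cutLog {σ ρ : ℝ} (hσ : σ = 1 ∨ σ = -1) (hρ : 0 < ρ) :
    Complex.exp (cutLog σ ρ) = -ρ := by
  have h : Complex.exp (σ * Real.pi * Complex.I) = -1 := by
    rcases hσ with rfl | rfl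
    · simp [Complex.exp_pi_mul_I]
    · rw [show ((-1 : ℝ) : ℂ) * Real.pi * Complex.I = -(Real.pi * Complex.I) by push_cast; ring,
        Complex.exp_neg, Complex.exp_pi_mul_I]
      norm_num
  rw [cutLog, Complex.exp_add, h, ← Complex.ofReal_exp, Real.exp_log hρ]
  ring

theorem cutLog_re (σ ρ : ℝ) : (cutLog σ ρ).re = Real.log ρ := by
  simp [cutLog]

theorem cutLog_im (σ ρ : ℝ) : (cutLog σ ρ).im = σ * Real.pi := by
  simp [cutLog]

theorem abs_cutLog_im {σ : ℝ} (hσ : σ = 1 ∨ σ = -1) (ρ : ℝ) : |(cutLog σ ρ).im| ≤ Real.pi := by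
  rw [cutLog_im]
  rcases hσ with rfl | rfl <;> simp [abs_of_pos Real.pi_pos]

theorem neg_ofReal_notMem_slitPlane {ρ : ℝ} (hρ : 0 < ρ) : (-ρ : ℂ) ∉ Complex.slitPlane := by
  simp [Complex.mem_slitPlane_iff, hρ.le]

theorem abs_log_im_le (s : ℂ) : |(Complex.log s).im| ≤ Real.pi := by
  rw [Complex.log_im]
  exact Complex.abs_arg_le_pi s

/-- The closed strip `|Im ζ| ≤ π` contains a single logarithm of a point off the cut. -/
theorem eq_log_of_exp_mem_slitPlane {ζ : ℂ} (hζ : |ζ.im| ≤ Real.pi)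
    (h : Complex.exp ζ ∈ Complex.slitPlane) : ζ = Complex.log (Complex.exp ζ) := by
  rw [abs_le] at hζ
  refine (Complex.log_exp (lt_of_le_of_ne hζ.1 fun h0 => ?_) hζ.2).symm
  have h1 : ζ = cutLog (-1) (Real.exp ζ.re) := by
    apply Complex.ext
    · simp [cutLog_re]
    · rw [cutLog_im, ← h0]; ring
  rw [h1, exp_cutLog (Or.inr rfl) (Real.exp_pos _)] at h
  exact neg_ofReal_notMem_slitPlane (Real.exp_pos _) h

/-- A function on the plane cut along `(-∞, 0]`, meromorphic with poles in the finite set `P` and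
with boundary values on both sides of the cut, that grows at most like `|s| ^ p`, `-1 < p < 0`, at
the origin and at infinity. It is given in the logarithmic coordinate `ζ = log s` as a function `h`
on the closed strip `|Im ζ| ≤ π`, whose boundary lines are the two sides of the cut. Differentiability
at the points of the boundary lines is required in the full plane, so `h` extends a little across
them. The values of `h` at the poles are arbitrary. -/
structure IsStripSymbol (h : ℂ → ℂ) (P : Finset ℂ) (p : ℝ) : Prop where
  slit : ∀ s ∈ P, s ∈ Complex.slitPlane
  diff : ∀ ζ : ℂ, |ζ.im| ≤ Real.pi → Complex.exp ζ ∉ P → DifferentiableAt ℂ h ζ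
  mero : ∀ s ∈ P, MeromorphicAt (fun s => h (Complex.log s)) s
  gt : -1 < p
  lt : p < 0
  bound : ∃ C X : ℝ, ∀ ζ : ℂ, |ζ.im| ≤ Real.pi → X ≤ |ζ.re| → ‖h ζ‖ ≤ C * Real.exp (p * ζ.re)

/-- The jump of `h` across the cut at `-ρ`: the value on the lower side minus that on the upper. -/
def cutJump (h : ℂ → ℂ) (ρ : ℝ) : ℂ := h (cutLog (-1) ρ) - h (cutLog 1 ρ)

namespace IsStripSymbol

variable {h : ℂ → ℂ} {P : Finset ℂ} {p : ℝ}

theorem differentiableAt_cutLog (H : IsStripSymbol h P p) {σ ρ : ℝ} (hσ : σ = 1 ∨ σ = -1)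
    (hρ : 0 < ρ) : DifferentiableAt ℂ h (cutLog σ ρ) := by
  refine H.diff _ (abs_cutLog_im hσ ρ) fun hm => ?_
  rw [exp_cutLog hσ hρ] at hm
  exact neg_ofReal_notMem_slitPlane hρ (H.slit _ hm)

theorem continuousOn_cutLog (H : IsStripSymbol h P p) {σ : ℝ} (hσ : σ = 1 ∨ σ = -1) :
    ContinuousOn (fun ρ => h (cutLog σ ρ)) (Ioi 0) := by
  intro ρ hρ
  have h1 : ContinuousAt (cutLog σ) ρ := by
    unfold cutLog
    have h2 : ContinuousAt Real.log ρ := Real.continuousAt_log (ne_of_gt hρ)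
    exact (Complex.continuous_ofReal.continuousAt.comp h2).add continuousAt_const
  exact ((H.differentiableAt_cutLog hσ hρ).continuousAt.comp (f := cutLog σ) h1).continuousWithinAt

theorem continuousOn_cutJump (H : IsStripSymbol h P p) : ContinuousOn (cutJump h) (Ioi 0) :=
  (H.continuousOn_cutLog (Or.inr rfl)).sub (H.continuousOn_cutLog (Or.inl rfl))

theorem exists_bound_cutLog (H : IsStripSymbol h P p) {σ : ℝ} (hσ : σ = 1 ∨ σ = -1) :
    ∃ C : ℝ, ∀ ρ : ℝ, 0 < ρ → ‖h (cutLog σ ρ)‖ ≤ C * ρ ^ p := by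
  obtain ⟨C, X, hCX⟩ := H.bound
  have hsub : Icc (Real.exp (-X)) (Real.exp X) ⊆ Ioi 0 := fun ρ hρ => (Real.exp_pos _).trans_le hρ.1
  have hc : ContinuousOn (fun ρ => ‖h (cutLog σ ρ)‖ / ρ ^ p)
      (Icc (Real.exp (-X)) (Real.exp X)) := by
    refine ((H.continuousOn_cutLog hσ).mono hsub).norm.div ?_ ?_
    · exact fun ρ hρ => (Real.continuousAt_rpow_const ρ p
        (Or.inl (ne_of_gt (hsub hρ)))).continuousWithinAt
    · exact fun ρ hρ => (Real.rpow_pos_of_pos (hsub hρ) p).ne'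
  obtain ⟨B, hB⟩ := isCompact_Icc.bddAbove_image hc
  refine ⟨max C B, fun ρ hρ => ?_⟩
  have hpow := Real.rpow_pos_of_pos hρ p
  rcases le_total X |Real.log ρ| with hX | hX
  · have := hCX (cutLog σ ρ) (abs_cutLog_im hσ ρ) (by rwa [cutLog_re])
    rw [cutLog_re, mul_comm p, ← Real.rpow_def_of_pos hρ] at this
    exact this.trans (mul_le_mul_of_nonneg_right (le_max_left _ _) hpow.le)
  · rw [abs_le] at hX
    have hmem : ρ ∈ Icc (Real.exp (-X)) (Real.exp X) := by
      constructor
      · rw [← Real.exp_log hρ]; exact Real.exp_le_exp.2 hX.1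
      · rw [← Real.exp_log hρ]; exact Real.exp_le_exp.2 hX.2
    have := hB (mem_image_of_mem _ hmem)
    rw [div_le_iff₀ hpow] at this
    exact this.trans (mul_le_mul_of_nonneg_right (le_max_right _ _) hpow.le)

theorem exists_bound_cutJump (H : IsStripSymbol h P p) :
    ∃ C : ℝ, 0 ≤ C ∧ ∀ ρ : ℝ, 0 < ρ → ‖cutJump h ρ‖ ≤ C * ρ ^ p := by
  obtain ⟨C, hC⟩ := H.exists_bound_cutLog (σ := -1) (Or.inr rfl)
  obtain ⟨C', hC'⟩ := H.exists_bound_cutLog (σ := 1) (Or.inl rfl)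
  have hb : ∀ ρ : ℝ, 0 < ρ → ‖cutJump h ρ‖ ≤ (C + C') * ρ ^ p := fun ρ hρ =>
    (norm_sub_le _ _).trans (by rw [add_mul]; exact add_le_add (hC ρ hρ) (hC' ρ hρ))
  refine ⟨C + C', ?_, hb⟩
  simpa using (norm_nonneg _).trans (hb 1 one_pos)

/-- The jump is integrable against the Stieltjes kernel. -/
theorem integrableOn_cutJump_div (H : IsStripSymbol h P p) {z : ℂ} (hz : z ∈ Complex.slitPlane) :
    IntegrableOn (fun ρ : ℝ => cutJump h ρ / (ρ + z)) (Ioi 0) := by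
  obtain ⟨C, hC0, hC⟩ := H.exists_bound_cutJump
  have hne : ∀ ρ : ℝ, 0 ≤ ρ → (ρ : ℂ) + z ≠ 0 := by
    intro ρ hρ h0
    rw [add_comm, add_eq_zero_iff_eq_neg] at h0
    rcases hρ.eq_or_lt with rfl | hρ
    · simp [h0, Complex.mem_slitPlane_iff] at hz
    · exact neg_ofReal_notMem_slitPlane hρ (h0 ▸ hz)
  have hcont : ContinuousOn (fun ρ : ℝ => cutJump h ρ / (ρ + z)) (Ioi 0) :=
    H.continuousOn_cutJump.div (by fun_prop) fun ρ hρ => hne ρ (le_of_lt hρ)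
  set M : ℝ := max 1 (2 * ‖z‖) with hM
  have hM0 : 0 < M := lt_max_of_lt_left one_pos
  rw [← Ioc_union_Ioi_eq_Ioi hM0.le]
  refine IntegrableOn.union ?_ ?_
  · obtain ⟨B, hB⟩ := isCompact_Icc.bddAbove_image (f := fun ρ : ℝ => ‖((ρ : ℂ) + z)⁻¹‖)
      (K := Icc 0 M) (ContinuousOn.norm (ContinuousOn.inv₀ (by fun_prop) fun ρ hρ => hne ρ hρ.1))
    have hint : IntegrableOn (fun ρ : ℝ => ρ ^ p * (C * B)) (Ioc 0 M) :=
      (((intervalIntegrable_iff_integrableOn_Ioc_of_le hM0.le).1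
        (intervalIntegral.intervalIntegrable_rpow' H.gt)).mul_const _)
    refine hint.mono' ((hcont.mono Ioc_subset_Ioi_self).aestronglyMeasurable measurableSet_Ioc) ?_
    filter_upwards [ae_restrict_mem measurableSet_Ioc] with ρ hρ
    have h1 : ‖((ρ : ℂ) + z)⁻¹‖ ≤ B := hB (mem_image_of_mem _ ⟨hρ.1.le, hρ.2⟩)
    have h2 := hC ρ hρ.1
    have h3 := Real.rpow_pos_of_pos hρ.1 p
    rw [div_eq_mul_inv, norm_mul]
    calc _ ≤ (C * ρ ^ p) * B := mul_le_mul h2 h1 (norm_nonneg _) (by positivity)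
      _ = _ := by ring
  · have hint : IntegrableOn (fun ρ : ℝ => ρ ^ (p - 1) * (2 * C)) (Ioi M) :=
      (integrableOn_Ioi_rpow_of_lt (by linarith [H.lt]) hM0).mul_const _
    refine hint.mono' ((hcont.mono (Ioi_subset_Ioi hM0.le)).aestronglyMeasurable
      measurableSet_Ioi) ?_
    filter_upwards [ae_restrict_mem measurableSet_Ioi] with ρ hρ
    have hMρ : M < ρ := hρ
    have hρ0 : 0 < ρ := hM0.trans hMρ
    have h1 : ρ / 2 ≤ ‖(ρ : ℂ) + z‖ := by
      have h4 := norm_sub_le_norm_add (ρ : ℂ) z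
      rw [Complex.norm_real, Real.norm_of_nonneg hρ0.le] at h4
      linarith [le_max_right 1 (2 * ‖z‖)]
    rw [norm_div, div_le_iff₀ (by linarith)]
    have h3 := Real.rpow_pos_of_pos hρ0 (p - 1)
    calc _ ≤ C * ρ ^ p := hC ρ hρ0
      _ = ρ ^ (p - 1) * (2 * C) * (ρ / 2) := by
        rw [Real.rpow_sub_one hρ0.ne']; field_simp
      _ ≤ _ := by gcongr

theorem hasComplexLaplace_cut (H : IsStripSymbol h P p) :
    HasComplexLaplace (fun t => ∫ ρ in Ioi (0 : ℝ), cutJump h ρ * Complex.exp (-ρ * t))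
      (fun s => ∫ ρ in Ioi (0 : ℝ), cutJump h ρ / (ρ + s)) := by
  refine HasComplexLaplace.stieltjes ?_
  have := H.integrableOn_cutJump_div (z := 1) (by simp)
  refine this.congr_fun (fun ρ _ => ?_) measurableSet_Ioi
  push_cast
  rw [add_comm]

end IsStripSymbol

/-! ### Stieltjes representation by Cauchy's theorem on the logarithmic strip -/

theorem integral_Ioi_eq_integral_comp_exp (f : ℝ → ℂ) :
    ∫ ρ in Ioi (0 : ℝ), f ρ = ∫ x : ℝ, Real.exp x • f (Real.exp x) := by
  have h := integral_image_eq_integral_abs_deriv_smul (s := univ) (f := Real.exp)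
    (f' := Real.exp) MeasurableSet.univ (fun x _ => (Real.hasDerivAt_exp x).hasDerivWithinAt)
    Real.exp_injective.injOn f
  simpa [image_univ, Real.range_exp, abs_of_pos (Real.exp_pos _)] using h

theorem integrable_comp_exp {f : ℝ → ℂ} (hf : IntegrableOn f (Ioi 0)) :
    Integrable fun x : ℝ => Real.exp x • f (Real.exp x) := by
  have h := integrableOn_image_iff_integrableOn_abs_deriv_smul (s := univ) (f := Real.exp)
    (f' := Real.exp) MeasurableSet.univ (fun x _ => (Real.hasDerivAt_exp x).hasDerivWithinAt)
    Real.exp_injective.injOn f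
  rw [image_univ, Real.range_exp] at h
  simpa [abs_of_pos (Real.exp_pos _)] using h.1 hf

/-- The Cauchy kernel `(k ζ - k ζ₀) e ^ ζ / (e ^ ζ - e ^ ζ₀)` in the logarithmic coordinate, with
its removable singularity at `ζ₀` removed. -/
def stripCauchyKernel (k : ℂ → ℂ) (ζ₀ ζ : ℂ) : ℂ :=
  dslope k ζ₀ ζ / dslope Complex.exp ζ₀ ζ * Complex.exp ζ

theorem stripCauchyKernel_of_ne (k : ℂ → ℂ) {ζ₀ ζ : ℂ} (h : Complex.exp ζ ≠ Complex.exp ζ₀) :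
    stripCauchyKernel k ζ₀ ζ
      = (k ζ - k ζ₀) * (Complex.exp ζ / (Complex.exp ζ - Complex.exp ζ₀)) := by
  have h1 : ζ ≠ ζ₀ := fun h' => h (by rw [h'])
  have h2 : ζ - ζ₀ ≠ 0 := sub_ne_zero.2 h1
  have h3 : Complex.exp ζ - Complex.exp ζ₀ ≠ 0 := sub_ne_zero.2 h
  rw [stripCauchyKernel, dslope_of_ne _ h1, dslope_of_ne _ h1, slope_def_field, slope_def_field]
  field_simp

namespace IsStripSymbol

variable {k : ℂ → ℂ} {p : ℝ}

/-- Cauchy's theorem for the regularized Cauchy kernel on `[-N, N] × [-π, π]`. -/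
theorem integral_stripCauchyKernel (H : IsStripSymbol k ∅ p) {z : ℂ} (hz : z ∈ Complex.slitPlane)
    (N : ℝ) :
    DifferentiableOn ℂ (stripCauchyKernel k (Complex.log z)) {ζ | |ζ.im| ≤ Real.pi} ∧
    (∫ x in (-N)..N, stripCauchyKernel k (Complex.log z) (x + ((-Real.pi : ℝ) : ℂ) * Complex.I))
      - (∫ x in (-N)..N, stripCauchyKernel k (Complex.log z) (x + (Real.pi : ℂ) * Complex.I))
      + Complex.I * (∫ y in (-Real.pi)..Real.pi,
          stripCauchyKernel k (Complex.log z) ((N : ℂ) + y * Complex.I))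
      - Complex.I * (∫ y in (-Real.pi)..Real.pi,
          stripCauchyKernel k (Complex.log z) (((-N : ℝ) : ℂ) + y * Complex.I)) = 0 := by
  have hz0 : z ≠ 0 := Complex.slitPlane_ne_zero hz
  have hd : DifferentiableOn ℂ (stripCauchyKernel k (Complex.log z)) {ζ | |ζ.im| ≤ Real.pi} := by
    have hnhds : {ζ : ℂ | |ζ.im| ≤ Real.pi} ∈ 𝓝 (Complex.log z) := by
      have ho : IsOpen {ζ : ℂ | |ζ.im| < Real.pi} :=
        isOpen_lt (Complex.continuous_im.abs) continuous_const
      refine mem_of_superset (ho.mem_nhds ?_) fun ζ (hζ : |ζ.im| < Real.pi) => hζ.le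
      change |(Complex.log z).im| < Real.pi
      rw [Complex.log_im]
      rw [Complex.mem_slitPlane_iff_arg] at hz
      exact lt_of_le_of_ne (Complex.abs_arg_le_pi z) fun h0 => by
        rcases abs_eq Real.pi_pos.le |>.1 h0 with h1 | h1
        · exact hz.1 h1
        · exact (Complex.neg_pi_lt_arg z).ne' h1
    refine DifferentiableOn.mul (DifferentiableOn.div ?_ ?_ ?_) (by fun_prop)
    · exact (Complex.differentiableOn_dslope hnhds).2 fun ζ hζ =>
        (H.diff ζ hζ (by simp)).differentiableWithinAt
    · exact (Complex.differentiableOn_dslope hnhds).2 (by fun_prop)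
    · intro ζ hζ
      by_cases h1 : ζ = Complex.log z
      · rw [h1, dslope_same, Complex.deriv_exp]
        exact Complex.exp_ne_zero _
      · rw [dslope_of_ne _ h1, slope_def_field]
        refine div_ne_zero (sub_ne_zero.2 fun h2 => h1 ?_) (sub_ne_zero.2 h1)
        rw [Complex.exp_log hz0] at h2
        have := eq_log_of_exp_mem_slitPlane hζ (h2 ▸ hz)
        rwa [h2] at this
  refine ⟨hd, ?_⟩
  have := Complex.integral_boundary_rect_eq_zero_of_differentiableOn
    (stripCauchyKernel k (Complex.log z)) ⟨-N, -Real.pi⟩ ⟨N, Real.pi⟩ (hd.mono ?_)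
  · simpa using this
  · intro ζ hζ
    have := hζ.2
    rw [mem_preimage, uIcc_of_le (by linarith [Real.pi_pos])] at this
    exact abs_le.2 this

/-- The contribution of the right side of the rectangle: `k` vanishes there in the limit and
`e ^ ζ / (e ^ ζ - z)` tends to `1`, so that only the constant `-k ζ₀` survives. -/
theorem tendsto_integral_right (H : IsStripSymbol k ∅ p) {z : ℂ} (hz : z ∈ Complex.slitPlane) :
    Tendsto (fun N : ℝ => ∫ y in (-Real.pi)..Real.pi,
      stripCauchyKernel k (Complex.log z) ((N : ℂ) + y * Complex.I)) atTop
      (𝓝 (2 * Real.pi * -k (Complex.log z))) := by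
  obtain ⟨C, X, hCX⟩ := H.bound
  have hz0 : z ≠ 0 := Complex.slitPlane_ne_zero hz
  have hval : (2 * Real.pi * -k (Complex.log z) : ℂ)
      = ∫ _ in (-Real.pi)..Real.pi, -k (Complex.log z) := by
    rw [intervalIntegral.integral_const]
    rw [Complex.real_smul]
    push_cast
    ring
  rw [hval]
  have him : ∀ N y : ℝ, y ∈ uIoc (-Real.pi) Real.pi → |((N : ℂ) + y * Complex.I).im| ≤ Real.pi := by
    intro N y hy
    rw [uIoc_of_le (by linarith [Real.pi_pos])] at hy
    simp [abs_le, hy.1.le, hy.2]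
  have hb1 : ∀ N y : ℝ, max X 0 ≤ N → y ∈ uIoc (-Real.pi) Real.pi →
      ‖k ((N : ℂ) + y * Complex.I)‖ ≤ C * Real.exp (p * N) := by
    intro N y hN hy
    have := hCX ((N : ℂ) + y * Complex.I) (him N y hy) (by
      simpa using (le_max_left X 0).trans (hN.trans (le_abs_self N)))
    simpa using this
  have hexpn : ∀ N y : ℝ, ‖Complex.exp ((N : ℂ) + y * Complex.I)‖ = Real.exp N := by
    intro N y; simp [Complex.norm_exp]
  have hlow : ∀ᶠ N : ℝ in atTop, 2 * ‖z‖ < Real.exp N :=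
    (Real.tendsto_exp_atTop.eventually_gt_atTop _)
  have hlow2 : ∀ N y : ℝ, 2 * ‖z‖ < Real.exp N →
      Real.exp N / 2 ≤ ‖Complex.exp ((N : ℂ) + y * Complex.I) - z‖ := by
    intro N y h
    have := norm_sub_norm_le (Complex.exp ((N : ℂ) + y * Complex.I)) z
    rw [hexpn] at this
    linarith
  have hq : ∀ N y : ℝ, 2 * ‖z‖ < Real.exp N →
      stripCauchyKernel k (Complex.log z) ((N : ℂ) + y * Complex.I)
        = (k ((N : ℂ) + y * Complex.I) - k (Complex.log z))
          * (Complex.exp ((N : ℂ) + y * Complex.I)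
            / (Complex.exp ((N : ℂ) + y * Complex.I) - z)) := by
    intro N y h
    have h3 := hlow2 N y h
    rw [stripCauchyKernel_of_ne, Complex.exp_log hz0]
    rw [Complex.exp_log hz0]
    intro h0
    rw [h0, sub_self, norm_zero] at h3
    linarith [Real.exp_pos N]
  refine intervalIntegral.tendsto_integral_filter_of_dominated_convergence
    (fun _ => (C + ‖k (Complex.log z)‖) * 2) ?_ ?_ (by simp) ?_
  · refine Eventually.of_forall fun N => ContinuousOn.aestronglyMeasurable ?_ measurableSet_uIoc
    have := (H.integral_stripCauchyKernel hz N).1.continuousOn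
    exact this.comp (f := fun y : ℝ => (N : ℂ) + y * Complex.I) (by fun_prop) fun y hy => him N y hy
  · filter_upwards [hlow, eventually_ge_atTop (max X 0)] with N hN hN'
    refine ae_of_all _ fun y hy => ?_
    rw [hq N y hN, norm_mul]
    have hN0 : 0 ≤ N := (le_max_right _ _).trans hN'
    have hC0 : 0 ≤ C := nonneg_of_mul_nonneg_left ((norm_nonneg _).trans (hb1 N y hN' hy))
      (Real.exp_pos _)
    refine mul_le_mul ((norm_sub_le _ _).trans (add_le_add ((hb1 N y hN' hy).trans ?_) le_rfl)) ?_
      (norm_nonneg _) (by positivity)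
    · have : Real.exp (p * N) ≤ 1 := Real.exp_le_one_iff.2
        (mul_nonpos_of_nonpos_of_nonneg H.lt.le hN0)
      nlinarith
    · have h3 := hlow2 N y hN
      rw [norm_div, hexpn, div_le_iff₀ (by linarith [Real.exp_pos N])]
      linarith
  · refine ae_of_all _ fun y hy => ?_
    have h1 : Tendsto (fun N : ℝ => k ((N : ℂ) + y * Complex.I)) atTop (𝓝 0) := by
      refine squeeze_zero_norm' (a := fun N : ℝ => C * Real.exp (p * N)) ?_ ?_
      · filter_upwards [eventually_ge_atTop (max X 0)] with N hN using hb1 N y hN hy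
      · have : Tendsto (fun N : ℝ => Real.exp (p * N)) atTop (𝓝 0) :=
          Real.tendsto_exp_atBot.comp (tendsto_id.const_mul_atTop_of_neg H.lt)
        simpa using this.const_mul C
    have h2 : Tendsto (fun N : ℝ => (1 - z * Complex.exp (-((N : ℂ) + y * Complex.I)))⁻¹) atTop
        (𝓝 1) := by
      have h3 : Tendsto (fun N : ℝ => Complex.exp (-((N : ℂ) + y * Complex.I))) atTop (𝓝 0) := by
        rw [tendsto_zero_iff_norm_tendsto_zero]
        have : (fun N : ℝ => ‖Complex.exp (-((N : ℂ) + y * Complex.I))‖)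
            = fun N => Real.exp (-N) := by
          ext N; simp [Complex.norm_exp]
        rw [this]
        exact Real.tendsto_exp_neg_atTop_nhds_zero
      have h4 : Tendsto (fun N : ℝ => 1 - z * Complex.exp (-((N : ℂ) + y * Complex.I))) atTop
          (𝓝 (1 - z * 0)) := tendsto_const_nhds.sub (h3.const_mul z)
      simpa using h4.inv₀ (by simp)
    have h5 : Tendsto (fun N : ℝ => (k ((N : ℂ) + y * Complex.I) - k (Complex.log z))
        * (1 - z * Complex.exp (-((N : ℂ) + y * Complex.I)))⁻¹) atTop
        (𝓝 ((0 - k (Complex.log z)) * 1)) := (h1.sub_const _).mul h2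
    rw [zero_sub, mul_one] at h5
    refine h5.congr' ?_
    filter_upwards [hlow] with N hN
    rw [hq N y hN]
    congr 1
    rw [Complex.exp_neg, ← div_eq_mul_inv, one_sub_div (Complex.exp_ne_zero _), inv_div]

/-- The contribution of the left side of the rectangle vanishes, because `e ^ ζ k ζ` does. -/
theorem tendsto_integral_left (H : IsStripSymbol k ∅ p) {z : ℂ} (hz : z ∈ Complex.slitPlane) :
    Tendsto (fun N : ℝ => ∫ y in (-Real.pi)..Real.pi,
      stripCauchyKernel k (Complex.log z) (((-N : ℝ) : ℂ) + y * Complex.I)) atTop (𝓝 0) := by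
  obtain ⟨C, X, hCX⟩ := H.bound
  have hz0 : z ≠ 0 := Complex.slitPlane_ne_zero hz
  have hzn : 0 < ‖z‖ := norm_pos_iff.2 hz0
  have hb : ∀ᶠ N : ℝ in atTop, ∀ y ∈ uIoc (-Real.pi) Real.pi,
      ‖stripCauchyKernel k (Complex.log z) (((-N : ℝ) : ℂ) + y * Complex.I)‖
        ≤ (C * Real.exp (-(1 + p) * N) + ‖k (Complex.log z)‖ * Real.exp (-N)) * (2 / ‖z‖) := by
    have h1 : ∀ᶠ N : ℝ in atTop, Real.exp (-N) < ‖z‖ / 2 :=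
      Real.tendsto_exp_neg_atTop_nhds_zero.eventually_lt_const (by positivity)
    filter_upwards [h1, eventually_ge_atTop (max X 0)] with N hN hN' y hy
    rw [uIoc_of_le (by linarith [Real.pi_pos])] at hy
    have hexpn : ‖Complex.exp (((-N : ℝ) : ℂ) + y * Complex.I)‖ = Real.exp (-N) := by
      simp [Complex.norm_exp]
    have hlow2 : ‖z‖ / 2 ≤ ‖Complex.exp (((-N : ℝ) : ℂ) + y * Complex.I) - z‖ := by
      have := norm_sub_norm_le z (Complex.exp (((-N : ℝ) : ℂ) + y * Complex.I))
      rw [hexpn, norm_sub_rev] at this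
      linarith
    have hk : ‖k (((-N : ℝ) : ℂ) + y * Complex.I)‖ ≤ C * Real.exp (p * -N) := by
      have := hCX (((-N : ℝ) : ℂ) + y * Complex.I) (by simp [abs_le, hy.1.le, hy.2]) (by
        simpa using (le_max_left X 0).trans (hN'.trans (le_abs_self N)))
      simpa using this
    rw [stripCauchyKernel_of_ne, Complex.exp_log hz0, norm_mul, norm_div, hexpn]
    · calc _ ≤ (C * Real.exp (p * -N) + ‖k (Complex.log z)‖) * (Real.exp (-N) / (‖z‖ / 2)) := by
            refine mul_le_mul ((norm_sub_le _ _).trans (add_le_add hk le_rfl))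
              (div_le_div_of_nonneg_left (Real.exp_pos _).le (by positivity) hlow2)
              (by positivity) (add_nonneg ((norm_nonneg _).trans hk) (norm_nonneg _))
        _ = _ := by
            have : Real.exp (-(1 + p) * N) = Real.exp (p * -N) * Real.exp (-N) := by
              rw [← Real.exp_add]; ring_nf
            rw [this]
            field_simp
    · rw [Complex.exp_log hz0]
      intro h0
      rw [h0, sub_self, norm_zero] at hlow2
      linarith
  refine squeeze_zero_norm'
    (a := fun N : ℝ => (C * Real.exp (-(1 + p) * N) + ‖k (Complex.log z)‖ * Real.exp (-N))
      * (2 / ‖z‖) * |Real.pi - -Real.pi|) ?_ ?_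
  · filter_upwards [hb] with N hN using intervalIntegral.norm_integral_le_of_norm_le_const hN
  · have h1 : Tendsto (fun N : ℝ => Real.exp (-(1 + p) * N)) atTop (𝓝 0) :=
      Real.tendsto_exp_atBot.comp (tendsto_id.const_mul_atTop_of_neg (by linarith [H.gt]))
    have h2 := (((h1.const_mul C).add ((Real.tendsto_exp_neg_atTop_nhds_zero).const_mul
      ‖k (Complex.log z)‖)).mul_const (2 / ‖z‖)).mul_const |Real.pi - -Real.pi|
    simpa using h2

/-- Without poles, a strip symbol is the Stieltjes transform of its jump across the cut. -/
theorem eq_stieltjes (H : IsStripSymbol k ∅ p) {z : ℂ} (hz : z ∈ Complex.slitPlane) :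
    2 * Real.pi * Complex.I * k (Complex.log z)
      = ∫ ρ in Ioi (0 : ℝ), cutJump k ρ / (ρ + z) := by
  have hz0 : z ≠ 0 := Complex.slitPlane_ne_zero hz
  have hint := H.integrableOn_cutJump_div hz
  have hexp : ∀ (σ x : ℝ), cutLog σ (Real.exp x) = (x : ℂ) + σ * Real.pi * Complex.I := by
    intro σ x; simp [cutLog]
  have hval : ∀ (σ x : ℝ), (σ = 1 ∨ σ = -1) →
      stripCauchyKernel k (Complex.log z) ((x : ℂ) + σ * Real.pi * Complex.I)
        = (k (cutLog σ (Real.exp x)) - k (Complex.log z))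
          * (Real.exp x / (Real.exp x + z)) := by
    intro σ x hσ
    have h1 : Complex.exp ((x : ℂ) + σ * Real.pi * Complex.I) = -(Real.exp x : ℂ) := by
      rw [← hexp, exp_cutLog hσ (Real.exp_pos x)]
    rw [stripCauchyKernel_of_ne, Complex.exp_log hz0, h1, hexp,
      show -(Real.exp x : ℂ) - z = -(Real.exp x + z) by ring, neg_div_neg_eq]
    rw [Complex.exp_log hz0, h1]
    intro h2
    exact neg_ofReal_notMem_slitPlane (Real.exp_pos x) (h2 ▸ hz)
  have hd := (H.integral_stripCauchyKernel hz 0).1.continuousOn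
  have hii : ∀ (σ N : ℝ), (σ = 1 ∨ σ = -1) → IntervalIntegrable
      (fun x : ℝ => stripCauchyKernel k (Complex.log z) ((x : ℂ) + σ * Real.pi * Complex.I))
      volume (-N) N := by
    intro σ N hσ
    refine ContinuousOn.intervalIntegrable ?_
    refine hd.comp (f := fun x : ℝ => (x : ℂ) + σ * Real.pi * Complex.I) (by fun_prop) fun x _ => ?_
    have := abs_cutLog_im hσ (Real.exp x)
    rwa [hexp] at this
  -- on the two horizontal sides `e ^ ζ = -e ^ x` is the same, so that `k ζ₀` cancels
  have h1 : ∀ N : ℝ,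
      (∫ x in (-N)..N, stripCauchyKernel k (Complex.log z) (x + ((-Real.pi : ℝ) : ℂ) * Complex.I))
      - (∫ x in (-N)..N, stripCauchyKernel k (Complex.log z) (x + (Real.pi : ℂ) * Complex.I))
      = ∫ x in (-N)..N, Real.exp x • (cutJump k (Real.exp x) / (Real.exp x + z)) := by
    intro N
    have e1 : ∀ x : ℝ, (x : ℂ) + ((-Real.pi : ℝ) : ℂ) * Complex.I
        = (x : ℂ) + ((-1 : ℝ) : ℂ) * Real.pi * Complex.I := by intro x; push_cast; ring
    have e2 : ∀ x : ℝ, (x : ℂ) + (Real.pi : ℂ) * Complex.I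
        = (x : ℂ) + ((1 : ℝ) : ℂ) * Real.pi * Complex.I := by intro x; push_cast; ring
    simp only [e1, e2]
    rw [← intervalIntegral.integral_sub (hii _ N (Or.inr rfl)) (hii _ N (Or.inl rfl))]
    refine intervalIntegral.integral_congr fun x _ => ?_
    rw [hval _ x (Or.inr rfl), hval _ x (Or.inl rfl), cutJump, Complex.real_smul]
    ring
  have h2 : Tendsto (fun N : ℝ => ∫ x in (-N)..N,
      Real.exp x • (cutJump k (Real.exp x) / (Real.exp x + z))) atTop
      (𝓝 (∫ ρ in Ioi (0 : ℝ), cutJump k ρ / (ρ + z))) := by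
    rw [integral_Ioi_eq_integral_comp_exp]
    exact intervalIntegral_tendsto_integral (integrable_comp_exp hint) tendsto_neg_atTop_atBot
      tendsto_id
  have h3 := ((H.tendsto_integral_right hz).const_mul Complex.I)
  have h4 := ((H.tendsto_integral_left hz).const_mul Complex.I)
  have h5 := (h2.add h3).sub h4
  have h6 := tendsto_nhds_unique h5 (tendsto_const_nhds.congr fun N => by
    rw [← h1 N, (H.integral_stripCauchyKernel hz N).2])
  rw [mul_zero, sub_zero] at h6
  linear_combination -h6

end IsStripSymbol

/-! ### Inverse Laplace transforms in the presence of poles -/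

/-- Approach to the two ends of the strip `|Im ζ| ≤ π`, that is, to the origin and to infinity of
the cut plane. -/
def stripEnds : Filter ℂ :=
  comap (fun ζ : ℂ => |ζ.re|) atTop ⊓ 𝓟 {ζ | |ζ.im| ≤ Real.pi}

theorem eventually_stripEnds {q : ℂ → Prop} :
    (∀ᶠ ζ in stripEnds, q ζ) ↔ ∃ X : ℝ, ∀ ζ : ℂ, |ζ.im| ≤ Real.pi → X ≤ |ζ.re| → q ζ := by
  rw [stripEnds, eventually_inf_principal, eventually_comap, eventually_atTop]
  constructor
  · rintro ⟨X, hX⟩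
    exact ⟨X, fun ζ h1 h2 => hX _ h2 ζ rfl h1⟩
  · rintro ⟨X, hX⟩
    exact ⟨X, fun b hb ζ h1 h2 => hX ζ h2 (h1 ▸ hb)⟩

theorem isBigO_stripEnds {f : ℂ → ℂ} {p : ℝ} :
    f =O[stripEnds] (fun ζ => Real.exp (p * ζ.re)) ↔
      ∃ C X : ℝ, ∀ ζ : ℂ, |ζ.im| ≤ Real.pi → X ≤ |ζ.re| → ‖f ζ‖ ≤ C * Real.exp (p * ζ.re) := by
  rw [Asymptotics.isBigO_iff]
  simp only [eventually_stripEnds, Real.norm_eq_abs, Real.abs_exp]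

theorem eventually_stripEnds_exp_notMem (P : Finset ℂ) :
    ∀ᶠ ζ in stripEnds, Complex.exp ζ ∉ P := by
  have : ∀ a ∈ P, ∀ᶠ ζ in stripEnds, Complex.exp ζ ≠ a := by
    intro a ha
    refine eventually_stripEnds.2 ⟨|Real.log ‖a‖| + 1, fun ζ _ h h1 => ?_⟩
    have : ζ.re = Real.log ‖a‖ := by rw [← h1, Complex.norm_exp, Real.log_exp]
    rw [this] at h
    linarith
  rw [← Finset.eventually_all] at this
  filter_upwards [this] with ζ hζ h
  exact hζ _ h rfl

theorem isBigO_stripEnds_inv_pow {a : ℂ} (ha : a ≠ 0) {p : ℝ} (h1 : -1 < p) (h2 : p < 0) (j : ℕ) :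
    (fun ζ => ((Complex.exp ζ - a) ^ (j + 1))⁻¹) =O[stripEnds]
      (fun ζ => Real.exp (p * ζ.re)) := by
  have han : 0 < ‖a‖ := norm_pos_iff.2 ha
  set X : ℝ := max (|Real.log (2 * ‖a‖ + 2)|) (|Real.log (‖a‖ / 2)|) with hX
  have hX0 : 0 ≤ X := (abs_nonneg _).trans (le_max_left _ _)
  refine isBigO_stripEnds.2 ⟨2 + (2 / ‖a‖) ^ (j + 1), X, fun ζ _ hζ => ?_⟩
  rw [norm_inv, norm_pow]
  have hn : ‖Complex.exp ζ‖ = Real.exp ζ.re := Complex.norm_exp ζ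
  have hpos := Real.exp_pos (p * ζ.re)
  rcases le_total 0 ζ.re with h0 | h0
  · rw [abs_of_nonneg h0] at hζ
    have h3 : 2 * ‖a‖ + 2 ≤ Real.exp ζ.re := by
      rw [← Real.exp_log (by positivity : 0 < 2 * ‖a‖ + 2)]
      exact Real.exp_le_exp.2 ((le_abs_self _).trans ((le_max_left _ _).trans hζ))
    have h4 : Real.exp ζ.re / 2 ≤ ‖Complex.exp ζ - a‖ := by
      have := norm_sub_norm_le (Complex.exp ζ) a
      linarith
    have h5 : ‖Complex.exp ζ - a‖ ≤ ‖Complex.exp ζ - a‖ ^ (j + 1) :=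
      le_self_pow₀ (by linarith) (by omega)
    calc (‖Complex.exp ζ - a‖ ^ (j + 1))⁻¹ ≤ (Real.exp ζ.re / 2)⁻¹ :=
          inv_anti₀ (by positivity) (h4.trans h5)
      _ = 2 * Real.exp (-ζ.re) := by rw [Real.exp_neg]; field_simp
      _ ≤ 2 * Real.exp (p * ζ.re) := by
          gcongr
          nlinarith
      _ ≤ _ := by
          gcongr
          have : 0 ≤ (2 / ‖a‖) ^ (j + 1) := by positivity
          linarith
  · rw [abs_of_nonpos h0] at hζ
    have h3 : Real.exp ζ.re ≤ ‖a‖ / 2 := by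
      rw [← Real.exp_log (by positivity : 0 < ‖a‖ / 2)]
      refine Real.exp_le_exp.2 ?_
      have := (neg_abs_le (Real.log (‖a‖ / 2)))
      have := le_max_right (|Real.log (2 * ‖a‖ + 2)|) (|Real.log (‖a‖ / 2)|)
      linarith
    have h4 : ‖a‖ / 2 ≤ ‖Complex.exp ζ - a‖ := by
      have := norm_sub_norm_le a (Complex.exp ζ)
      rw [norm_sub_rev] at this
      linarith
    calc (‖Complex.exp ζ - a‖ ^ (j + 1))⁻¹ ≤ ((‖a‖ / 2) ^ (j + 1))⁻¹ :=
          inv_anti₀ (by positivity) (by gcongr)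
      _ = (2 / ‖a‖) ^ (j + 1) * 1 := by rw [← inv_pow, inv_div, mul_one]
      _ ≤ (2 + (2 / ‖a‖) ^ (j + 1)) * Real.exp (p * ζ.re) := by
          refine mul_le_mul (by linarith) (Real.one_le_exp (mul_nonneg_of_nonpos_of_nonpos h2.le h0))
            zero_le_one (by positivity)

namespace IsStripSymbol

variable {h : ℂ → ℂ} {P : Finset ℂ} {p : ℝ}

/-- A strip symbol is the sum of its principal parts and of the Stieltjes transform of its jump.
The principal parts also give the residues of `h(log s) e ^ (s t)`. -/
theorem exists_decomposition (H : IsStripSymbol h P p) : ∃ (n : ℂ → ℕ) (c : ℂ → ℕ → ℂ),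
    (∀ z ∈ Complex.slitPlane, z ∉ P → h (Complex.log z)
      = ∑ a ∈ P, ∑ j ∈ Finset.range (n a), c a j * ((z - a) ^ (j + 1))⁻¹
        + (2 * Real.pi * Complex.I)⁻¹ * ∫ ρ in Ioi (0 : ℝ), cutJump h ρ / (ρ + z)) ∧
    ∀ a ∈ P, ∀ t : ℂ, cresidue (fun s => h (Complex.log s) * Complex.exp (s * t)) a
      = ∑ j ∈ Finset.range (n a), c a j * (t ^ j / j.factorial * Complex.exp (a * t)) := by
  classical
  have hex : ∀ a : ℂ, ∃ (n : ℕ) (c : ℕ → ℂ) (E : ℂ → ℂ), a ∈ P → AnalyticAt ℂ E a ∧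
      ∀ s ≠ a, h (Complex.log s) = ∑ j ∈ Finset.range n, c j * ((s - a) ^ (j + 1))⁻¹ + E s := by
    intro a
    by_cases ha : a ∈ P
    · obtain ⟨n, c, E, h1⟩ := (H.mero a ha).exists_principalPart
      exact ⟨n, c, E, fun _ => h1⟩
    · exact ⟨0, 0, 0, fun h' => absurd h' ha⟩
  choose n c E hE using hex
  refine ⟨n, c, ?_, fun a ha t => cresidue_mul_exp (hE a ha).1 (hE a ha).2 t⟩
  set pp : ℂ → ℂ → ℂ := fun a s => ∑ j ∈ Finset.range (n a), c a j * ((s - a) ^ (j + 1))⁻¹ with hpp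
  -- at its own pole a principal part has the value `0`, since `0⁻¹ = 0`
  have hpp0 : ∀ a, pp a a = 0 := by intro a; simp [hpp]
  have hppd : ∀ a s, s ≠ a → DifferentiableAt ℂ (pp a) s := by
    intro a s hs
    have : ∀ j, (s - a) ^ (j + 1) ≠ 0 := fun j => pow_ne_zero _ (sub_ne_zero.2 hs)
    refine DifferentiableAt.fun_sum fun j _ => DifferentiableAt.const_mul ?_ _
    have h1 := this j
    fun_prop (disch := assumption)
  -- subtract the principal parts and fill in the values at the poles
  set k : ℂ → ℂ := fun ζ => (if Complex.exp ζ ∈ P then E (Complex.exp ζ) (Complex.exp ζ) else h ζ)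
    - ∑ a ∈ P, pp a (Complex.exp ζ) with hk
  have hk1 : ∀ ζ, Complex.exp ζ ∉ P → k ζ = h ζ - ∑ a ∈ P, pp a (Complex.exp ζ) := by
    intro ζ hζ
    simp only [hk, if_neg hζ]
  have K : IsStripSymbol k ∅ p := by
    refine ⟨by simp, fun ζ hζ _ => ?_, by simp, H.gt, H.lt, ?_⟩
    · by_cases hb : Complex.exp ζ ∈ P
      -- near a pole `b`, `k` is the regular part at `b` minus the other principal parts
      · set b := Complex.exp ζ with hbdef
        have hlog : ζ = Complex.log b := eq_log_of_exp_mem_slitPlane hζ (H.slit b hb)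
        have hnear : ∀ᶠ ζ' in 𝓝 ζ, Complex.log (Complex.exp ζ') = ζ' := by
          have harg := Complex.mem_slitPlane_iff_arg.1 (H.slit b hb)
          have him : ζ.im = b.arg := by rw [hlog, Complex.log_im]
          have h1 : -Real.pi < ζ.im := him ▸ Complex.neg_pi_lt_arg b
          have h2 : ζ.im < Real.pi := him ▸ lt_of_le_of_ne (Complex.arg_le_pi b) harg.1
          filter_upwards [Complex.continuous_im.continuousAt.eventually_const_lt h1,
            Complex.continuous_im.continuousAt.eventually_lt_const h2] with ζ' h3 h4
          exact Complex.log_exp h3 h4.le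
        have hoth : ∀ᶠ ζ' in 𝓝 ζ, Complex.exp ζ' ∉ P.erase b := by
          have : ((P.erase b : Finset ℂ) : Set ℂ)ᶜ ∈ 𝓝 (Complex.exp ζ) :=
            (P.erase b).finite_toSet.isClosed.isOpen_compl.mem_nhds (by simp [← hbdef])
          exact Complex.continuous_exp.continuousAt.eventually this
        have hev : k =ᶠ[𝓝 ζ] fun ζ' => E b (Complex.exp ζ')
            - ∑ a ∈ P.erase b, pp a (Complex.exp ζ') := by
          filter_upwards [hnear, hoth] with ζ' h1 h2
          rw [hk]
          simp only
          rw [← Finset.add_sum_erase P _ hb]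
          by_cases h3 : Complex.exp ζ' = b
          · rw [h3, if_pos hb, hpp0, zero_add]
          · have h5 := h1
            apply_fun h at h5
            rw [if_neg fun h4 => h2 (Finset.mem_erase.2 ⟨h3, h4⟩), ← h5,
              (hE b hb).2 _ h3]
            ring
        refine DifferentiableAt.congr_of_eventuallyEq (DifferentiableAt.sub ?_ ?_) hev
        · exact ((hE b hb).1.differentiableAt).comp ζ Complex.differentiableAt_exp
        · exact DifferentiableAt.fun_sum fun a ha =>
            (hppd a b (Finset.ne_of_mem_erase ha).symm).comp ζ Complex.differentiableAt_exp
      · have hev : k =ᶠ[𝓝 ζ] fun ζ' => h ζ' - ∑ a ∈ P, pp a (Complex.exp ζ') := by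
          have : ((P : Finset ℂ) : Set ℂ)ᶜ ∈ 𝓝 (Complex.exp ζ) :=
            P.finite_toSet.isClosed.isOpen_compl.mem_nhds hb
          filter_upwards [Complex.continuous_exp.continuousAt.eventually this] with ζ' h1
          exact hk1 ζ' h1
        refine DifferentiableAt.congr_of_eventuallyEq (DifferentiableAt.sub (H.diff ζ hζ hb) ?_) hev
        exact DifferentiableAt.fun_sum fun a ha =>
          (hppd a (Complex.exp ζ) (fun h' => hb (by rwa [h']))).comp ζ Complex.differentiableAt_exp
    · have hne : ∀ s ∈ P, s ≠ 0 := fun s hs => Complex.slitPlane_ne_zero (H.slit s hs)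
      rw [← isBigO_stripEnds]
      have h1 : (fun ζ => h ζ - ∑ a ∈ P, pp a (Complex.exp ζ)) =O[stripEnds]
          (fun ζ => Real.exp (p * ζ.re)) := by
        refine (isBigO_stripEnds.2 H.bound).sub (Asymptotics.IsBigO.fun_sum fun a ha => ?_)
        exact Asymptotics.IsBigO.fun_sum fun j _ =>
          (isBigO_stripEnds_inv_pow (hne a ha) H.gt H.lt j).const_mul_left _
      refine h1.congr' ?_ EventuallyEq.rfl
      filter_upwards [eventually_stripEnds_exp_notMem P] with ζ hζ
      exact (hk1 ζ hζ).symm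
  intro z hz hzP
  have hz0 : Complex.exp (Complex.log z) = z := Complex.exp_log (Complex.slitPlane_ne_zero hz)
  have h1 := K.eq_stieltjes hz
  have h2 : ∫ ρ in Ioi (0 : ℝ), cutJump k ρ / (ρ + z) = ∫ ρ in Ioi (0 : ℝ), cutJump h ρ / (ρ + z) := by
    refine setIntegral_congr_fun measurableSet_Ioi fun ρ hρ => ?_
    have hP : (-ρ : ℂ) ∉ P := fun h' => neg_ofReal_notMem_slitPlane hρ (H.slit _ h')
    have e1 := exp_cutLog (σ := 1) (Or.inl rfl) hρ
    have e2 := exp_cutLog (σ := -1) (Or.inr rfl) hρ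
    simp only [cutJump]
    rw [hk1 _ (by rwa [e2]), hk1 _ (by rwa [e1]), e1, e2]
    ring
  have hpi : (2 * Real.pi * Complex.I : ℂ) ≠ 0 := by simp [Real.pi_ne_zero]
  rw [h2, hk1 _ (by rwa [hz0]), hz0] at h1
  rw [← h1, inv_mul_cancel_left₀ hpi]
  ring

/-- The inverse Laplace transform of `h(log s)`: the residues of `h(log s) e ^ (s t)` and the
integral of the jump along the cut. -/
def _root_.stripOriginal (h : ℂ → ℂ) (P : Finset ℂ) (t : ℝ) : ℂ :=
  ∑ a ∈ P, cresidue (fun s => h (Complex.log s) * Complex.exp (s * t)) a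
    + (2 * Real.pi * Complex.I)⁻¹ * ∫ ρ in Ioi (0 : ℝ), cutJump h ρ * Complex.exp (-ρ * t)

theorem hasComplexLaplace_stripOriginal (H : IsStripSymbol h P p) :
    HasComplexLaplace (stripOriginal h P) (fun s => h (Complex.log s)) := by
  obtain ⟨n, c, h1, h2⟩ := H.exists_decomposition
  have h3 := (HasComplexLaplace.sum P fun a _ => HasComplexLaplace.sum (Finset.range (n a))
    fun j _ => (HasComplexLaplace.pow_mul_exp a j).const_mul (c a j)).add
      (H.hasComplexLaplace_cut.const_mul (2 * Real.pi * Complex.I)⁻¹)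
  have h4 : (fun t : ℝ => ∑ a ∈ P, ∑ j ∈ Finset.range (n a),
      c a j * ((t : ℂ) ^ j / j.factorial * Complex.exp (a * t))
      + (2 * Real.pi * Complex.I)⁻¹ * ∫ ρ in Ioi (0 : ℝ), cutJump h ρ * Complex.exp (-ρ * t))
      = stripOriginal h P := by
    ext t
    rw [stripOriginal]
    congr 1
    exact (Finset.sum_congr rfl fun a ha => h2 a ha t).symm
  rw [h4] at h3
  refine h3.congr_transform (∑ a ∈ P, ‖a‖) fun s hs => (h1 s ?_ ?_).symm
  · have : 0 ≤ ∑ a ∈ P, ‖a‖ := Finset.sum_nonneg fun a _ => norm_nonneg a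
    exact Or.inl (this.trans_lt hs)
  · intro hsP
    have h5 := Finset.single_le_sum (f := fun a : ℂ => ‖a‖) (fun a _ => norm_nonneg a) hsP
    exact absurd (hs.trans_le (Complex.re_le_norm s)) (not_lt.2 h5)

theorem continuous_residues (H : IsStripSymbol h P p) :
    Continuous fun t : ℝ =>
      ∑ a ∈ P, cresidue (fun s => h (Complex.log s) * Complex.exp (s * t)) a := by
  obtain ⟨n, c, -, h2⟩ := H.exists_decomposition
  have : (fun t : ℝ => ∑ a ∈ P, cresidue (fun s => h (Complex.log s) * Complex.exp (s * t)) a)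
      = fun t : ℝ => ∑ a ∈ P, ∑ j ∈ Finset.range (n a),
        c a j * ((t : ℂ) ^ j / j.factorial * Complex.exp (a * t)) := by
    ext t
    exact Finset.sum_congr rfl fun a ha => h2 a ha t
  rw [this]
  fun_prop

theorem integrableOn_rpow_mul_exp_neg (H : IsStripSymbol h P p) {t : ℝ} (ht : 0 < t) :
    IntegrableOn (fun ρ : ℝ => ρ ^ p * Real.exp (-(t * ρ))) (Ioi 0) := by
  have := integrableOn_rpow_mul_exp_neg_mul_rpow H.gt one_pos ht
  simpa using this

theorem integrableOn_cutJump_mul_exp (H : IsStripSymbol h P p) {s : ℂ} (hs : 0 < s.re) :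
    IntegrableOn (fun ρ : ℝ => Complex.exp (-s * ρ) * cutJump h ρ) (Ioi 0) := by
  obtain ⟨C, hC0, hC⟩ := H.exists_bound_cutJump
  refine ((H.integrableOn_rpow_mul_exp_neg hs).const_mul C).mono'
    ((ContinuousOn.mul (by fun_prop) H.continuousOn_cutJump).aestronglyMeasurable
      measurableSet_Ioi) ?_
  filter_upwards [ae_restrict_mem measurableSet_Ioi] with ρ hρ
  rw [norm_mul, Complex.norm_exp, show (-s * (ρ : ℂ)).re = -(s.re * ρ) by simp]
  have := hC ρ hρ
  have h1 := Real.exp_pos (-(s.re * ρ))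
  calc _ ≤ Real.exp (-(s.re * ρ)) * (C * ρ ^ p) := by gcongr
    _ = _ := by ring

theorem continuousOn_stripOriginal (H : IsStripSymbol h P p) :
    ContinuousOn (stripOriginal h P) (Ioi 0) := by
  refine H.continuous_residues.continuousOn.add (continuousOn_const.mul ?_)
  have h1 := (differentiableOn_laplace fun s hs =>
    H.integrableOn_cutJump_mul_exp (s := s) hs).continuousOn
  have h2 := h1.comp (f := fun t : ℝ => (t : ℂ)) (s := Ioi 0) (by fun_prop) (fun t ht => by
    simpa using ht)
  refine h2.congr fun t _ => ?_
  refine integral_congr_ae (ae_of_all _ fun ρ => ?_)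
  simp only
  rw [mul_comm]
  ring_nf

/-- If the jump is integrable, the inverse transform is continuous up to `t = 0`. -/
theorem continuousOn_Ici_stripOriginal (H : IsStripSymbol h P p)
    (hint : IntegrableOn (cutJump h) (Ioi 0)) : ContinuousOn (stripOriginal h P) (Ici 0) := by
  refine H.continuous_residues.continuousOn.add (continuousOn_const.mul ?_)
  refine continuousOn_of_dominated (bound := fun ρ => ‖cutJump h ρ‖) ?_ ?_ hint.norm ?_
  · exact fun t _ => hint.aestronglyMeasurable.mul (by fun_prop)
  · intro t ht
    filter_upwards [ae_restrict_mem measurableSet_Ioi] with ρ hρ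
    have h0 : 0 ≤ ρ * t := mul_nonneg (le_of_lt hρ) ht
    rw [norm_mul, Complex.norm_exp, show (-(ρ : ℂ) * (t : ℂ)).re = -(ρ * t) by simp]
    exact mul_le_of_le_one_right (norm_nonneg _) (Real.exp_le_one_iff.2 (by linarith))
  · exact ae_of_all _ fun ρ => by fun_prop

/-- The singularity of the inverse transform at `t = 0`. -/
theorem exists_bound_stripOriginal (H : IsStripSymbol h P p) (T : ℝ) :
    ∃ C : ℝ, ∀ t : ℝ, 0 < t → t ≤ T → ‖stripOriginal h P t‖ ≤ C * t ^ (-(p + 1)) := by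
  obtain ⟨C, hC0, hC⟩ := H.exists_bound_cutJump
  obtain ⟨B, hB⟩ := isCompact_Icc.bddAbove_image (K := Icc 0 T)
    (H.continuous_residues.norm.continuousOn)
  have hp := H.gt
  set M := ‖(2 * Real.pi * Complex.I : ℂ)⁻¹‖
  refine ⟨B * T ^ (p + 1) + M * (C * Real.Gamma (p + 1)), fun t ht htT => ?_⟩
  have hB' := hB (mem_image_of_mem _ ⟨ht.le, htT⟩)
  have hB0 : 0 ≤ B := (norm_nonneg _).trans hB'
  have hpow := Real.rpow_pos_of_pos ht (-(p + 1))
  have h1 : ‖∫ ρ in Ioi (0 : ℝ), cutJump h ρ * Complex.exp (-ρ * t)‖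
      ≤ C * Real.Gamma (p + 1) * t ^ (-(p + 1)) := by
    have h2 : ∫ ρ in Ioi (0 : ℝ), C * (ρ ^ p * Real.exp (-(t * ρ)))
        = C * Real.Gamma (p + 1) * t ^ (-(p + 1)) := by
      rw [integral_const_mul]
      have := Real.integral_rpow_mul_exp_neg_mul_Ioi (a := p + 1) (by linarith) ht
      rw [add_sub_cancel_right] at this
      rw [this, one_div, Real.inv_rpow ht.le, Real.rpow_neg ht.le]
      ring
    rw [← h2]
    refine norm_integral_le_of_norm_le ((H.integrableOn_rpow_mul_exp_neg ht).const_mul C) ?_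
    filter_upwards [ae_restrict_mem measurableSet_Ioi] with ρ hρ
    rw [norm_mul, Complex.norm_exp, show (-(ρ : ℂ) * (t : ℂ)).re = -(t * ρ) by simp; ring,
      ← mul_assoc]
    exact mul_le_mul_of_nonneg_right (hC ρ hρ) (Real.exp_pos _).le
  have h3 : 1 ≤ T ^ (p + 1) * t ^ (-(p + 1)) := by
    rw [Real.rpow_neg ht.le, ← div_eq_mul_inv, one_le_div (Real.rpow_pos_of_pos ht _)]
    exact Real.rpow_le_rpow ht.le htT (by linarith)
  calc ‖stripOriginal h P t‖ ≤ B + M * (C * Real.Gamma (p + 1) * t ^ (-(p + 1))) := by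
        refine (norm_add_le _ _).trans (add_le_add hB' ?_)
        rw [norm_mul]
        exact mul_le_mul_of_nonneg_left h1 (norm_nonneg _)
    _ ≤ B * (T ^ (p + 1) * t ^ (-(p + 1))) + M * (C * Real.Gamma (p + 1) * t ^ (-(p + 1))) := by
        gcongr
        exact le_mul_of_one_le_right hB0 h3
    _ = _ := by ring

end IsStripSymbol

/-! ### The exponent `s A(s)` -/

/-- The exponent `s A(s) = (α₁ s ^ β + α₂ c) / (s ^ β + c)` at the point `s` with logarithm `ℓ`. -/
def mlOrder (α₁ α₂ β c : ℝ) (ℓ : ℂ) : ℂ := Complex.exp ℓ * mlA α₁ α₂ β c ℓ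

/-- The kernel symbol `s ^ (s A(s) - 1)` at the point `s` with logarithm `ℓ`. -/
def kernelSymbol (α₁ α₂ β c : ℝ) (ℓ : ℂ) : ℂ := powLog ℓ (mlOrder α₁ α₂ β c ℓ - 1)

theorem relaxDenom_eq (α₁ α₂ β c lam : ℝ) (ℓ : ℂ) :
    relaxDenom α₁ α₂ β c lam ℓ = powLog ℓ (mlOrder α₁ α₂ β c ℓ) + lam := rfl

theorem relaxSymbol_eq (α₁ α₂ β c lam : ℝ) (ℓ : ℂ) :
    relaxSymbol α₁ α₂ β c lam ℓ
      = kernelSymbol α₁ α₂ β c ℓ * (relaxDenom α₁ α₂ β c lam ℓ)⁻¹ := by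
  rw [← div_eq_mul_inv]; rfl

theorem kernelSymbol_eq (α₁ α₂ β c : ℝ) (ℓ : ℂ) :
    kernelSymbol α₁ α₂ β c ℓ = powLog ℓ (mlOrder α₁ α₂ β c ℓ) * Complex.exp (-ℓ) := by
  rw [kernelSymbol, powLog, powLog, ← Complex.exp_add]
  ring_nf

theorem norm_powLog_ofReal (β : ℝ) (ζ : ℂ) : ‖powLog ζ β‖ = Real.exp (β * ζ.re) := by
  rw [powLog, Complex.norm_exp]
  simp

/-- `s ^ β` stays away from the negative axis in the closed cut plane. -/
theorem le_norm_powLog_add {β c : ℝ} (hβ₀ : 0 < β) (hβ₁ : β < 1) (hc : 0 < c) {ζ : ℂ}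
    (hζ : |ζ.im| ≤ Real.pi) :
    Real.cos (β * Real.pi / 2) * (Real.exp (β * ζ.re) + c) ≤ ‖powLog ζ β + c‖ := by
  set r := Real.exp (β * ζ.re) with hr
  set κ := Real.cos (β * Real.pi / 2) with hκ
  have hpi := Real.pi_pos
  have hw : powLog ζ β = (r * Real.cos (β * ζ.im) : ℝ) + (r * Real.sin (β * ζ.im) : ℝ) * Complex.I := by
    rw [powLog, Complex.exp_eq_exp_re_mul_sin_add_cos]
    simp only [Complex.mul_re, Complex.mul_im, Complex.ofReal_re, Complex.ofReal_im]
    push_cast [hr]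
    ring_nf
  have hcos : 2 * κ ^ 2 - 1 ≤ Real.cos (β * ζ.im) := by
    rw [hκ, ← Real.cos_two_mul, ← Real.cos_abs (β * ζ.im), abs_mul, abs_of_pos hβ₀]
    refine Real.cos_le_cos_of_nonneg_of_le_pi (by positivity) ?_ ?_
    · nlinarith
    · nlinarith
  have hsq : ‖powLog ζ β + c‖ ^ 2 = r ^ 2 + c ^ 2 + 2 * r * c * Real.cos (β * ζ.im) := by
    have e : powLog ζ β + c = ((r * Real.cos (β * ζ.im) + c : ℝ) : ℂ)
        + (r * Real.sin (β * ζ.im) : ℝ) * Complex.I := by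
      rw [hw]; push_cast; ring
    rw [e, Complex.sq_norm, Complex.normSq_add_mul_I]
    linear_combination r ^ 2 * Real.sin_sq_add_cos_sq (β * ζ.im)
  have hr0 : 0 < r := Real.exp_pos _
  refine le_of_sq_le_sq ?_ (norm_nonneg _)
  rw [hsq]
  -- the difference of the two sides is at least `(1 - κ ^ 2) (r - c) ^ 2`
  have h1 : κ ^ 2 ≤ 1 := by
    rw [hκ]; exact Real.cos_sq_le_one _
  have h2 : 2 * r * c * (2 * κ ^ 2 - 1) ≤ 2 * r * c * Real.cos (β * ζ.im) := by gcongr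
  nlinarith [mul_nonneg (sub_nonneg.2 h1) (sq_nonneg (r - c))]

/-- The symbols are analytic on the open strip `|Im ζ| < π / β`, which contains the closed strip
`|Im ζ| ≤ π`: there `s ^ β + c` has no zeros. -/
theorem powLog_add_ne_zero {β c : ℝ} (hβ₀ : 0 < β) (hc : 0 < c) {ζ : ℂ}
    (hζ : |ζ.im| < Real.pi / β) : powLog ζ β + c ≠ 0 := by
  intro h0
  rw [lt_div_iff₀ hβ₀] at hζ
  have him : (β * ζ : ℂ).im = β * ζ.im := by simp
  have h1 : |(β * ζ : ℂ).im| < Real.pi := by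
    rw [him, abs_mul, abs_of_pos hβ₀]
    linarith
  have h2 : Complex.exp (β * ζ) = ((-c : ℝ) : ℂ) := by
    rw [powLog] at h0
    push_cast
    linear_combination h0
  have h3 := congrArg Complex.im (Complex.log_exp (abs_lt.1 h1).1 (abs_lt.1 h1).2.le)
  rw [h2, Complex.log_im, Complex.arg_ofReal_of_neg (by linarith)] at h3
  rw [← h3, abs_of_pos Real.pi_pos] at h1
  exact lt_irrefl _ h1

theorem mlOrder_eq (α₁ α₂ β c : ℝ) (ζ : ℂ) :
    mlOrder α₁ α₂ β c ζ = (α₁ * powLog ζ β + α₂ * c) / (powLog ζ β + c) := by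
  rw [mlOrder, mlA, mul_div_assoc', mul_div_mul_left _ _ (Complex.exp_ne_zero ζ)]

theorem differentiableAt_mlOrder (α₁ α₂ : ℝ) {β c : ℝ} (hβ₀ : 0 < β) (hc : 0 < c) {ζ : ℂ}
    (hζ : |ζ.im| < Real.pi / β) : DifferentiableAt ℂ (mlOrder α₁ α₂ β c) ζ := by
  have h1 := powLog_add_ne_zero hβ₀ hc hζ
  have h2 : mlOrder α₁ α₂ β c
      = fun ζ => (α₁ * Complex.exp (β * ζ) + α₂ * c) / (Complex.exp (β * ζ) + c) := by
    ext ζ; exact mlOrder_eq _ _ _ _ ζ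
  rw [h2]
  rw [powLog] at h1
  fun_prop (disch := assumption)

theorem differentiableAt_powLog_mlOrder (α₁ α₂ : ℝ) {β c : ℝ} (hβ₀ : 0 < β) (hc : 0 < c) {ζ : ℂ}
    (hζ : |ζ.im| < Real.pi / β) :
    DifferentiableAt ℂ (fun ζ => powLog ζ (mlOrder α₁ α₂ β c ζ)) ζ :=
  ((differentiableAt_mlOrder α₁ α₂ hβ₀ hc hζ).mul differentiableAt_id).cexp

theorem differentiableAt_kernelSymbol (α₁ α₂ : ℝ) {β c : ℝ} (hβ₀ : 0 < β) (hc : 0 < c) {ζ : ℂ}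
    (hζ : |ζ.im| < Real.pi / β) : DifferentiableAt ℂ (kernelSymbol α₁ α₂ β c) ζ :=
  (((differentiableAt_mlOrder α₁ α₂ hβ₀ hc hζ).sub_const 1).mul differentiableAt_id).cexp

theorem differentiableAt_relaxDenom (α₁ α₂ lam : ℝ) {β c : ℝ} (hβ₀ : 0 < β) (hc : 0 < c) {ζ : ℂ}
    (hζ : |ζ.im| < Real.pi / β) : DifferentiableAt ℂ (relaxDenom α₁ α₂ β c lam) ζ :=
  (differentiableAt_powLog_mlOrder α₁ α₂ hβ₀ hc hζ).add_const _

theorem isOpen_abs_im_lt (r : ℝ) : IsOpen {ζ : ℂ | |ζ.im| < r} :=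
  isOpen_lt (Complex.continuous_im.abs) continuous_const

theorem analyticOnNhd_relaxDenom (α₁ α₂ lam : ℝ) {β c : ℝ} (hβ₀ : 0 < β) (hc : 0 < c) :
    AnalyticOnNhd ℂ (relaxDenom α₁ α₂ β c lam) {ζ | |ζ.im| < Real.pi / β} :=
  DifferentiableOn.analyticOnNhd (fun _ hζ =>
    (differentiableAt_relaxDenom α₁ α₂ lam hβ₀ hc hζ).differentiableWithinAt) (isOpen_abs_im_lt _)

theorem analyticOnNhd_kernelSymbol (α₁ α₂ : ℝ) {β c : ℝ} (hβ₀ : 0 < β) (hc : 0 < c) :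
    AnalyticOnNhd ℂ (kernelSymbol α₁ α₂ β c) {ζ | |ζ.im| < Real.pi / β} :=
  DifferentiableOn.analyticOnNhd (fun _ hζ =>
    (differentiableAt_kernelSymbol α₁ α₂ hβ₀ hc hζ).differentiableWithinAt) (isOpen_abs_im_lt _)

theorem lt_pi_div_of_le_pi {β : ℝ} (hβ₀ : 0 < β) (hβ₁ : β < 1) {x : ℝ} (hx : |x| ≤ Real.pi) :
    |x| < Real.pi / β := by
  rw [lt_div_iff₀ hβ₀]
  nlinarith [Real.pi_pos]

/-- In the closed cut plane `s ^ (s A(s))` is comparable to `s ^ α₁` at infinity and to `s ^ α₂` at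
the origin, because `s A(s) - α₁` and `s A(s) - α₂` decay there like a power of `s`, faster than
`log s` grows. -/
theorem exists_bound_mlOrder {α₁ α₂ β c : ℝ} (hα : |α₂ - α₁| ≤ 1) (hβ₀ : 0 < β) (hβ₁ : β < 1)
    (hc : 0 < c) : ∃ M : ℝ, ∀ ζ : ℂ, |ζ.im| ≤ Real.pi →
      (0 ≤ ζ.re → |(mlOrder α₁ α₂ β c ζ * ζ).re - α₁ * ζ.re| ≤ M) ∧
      (ζ.re ≤ 0 → |(mlOrder α₁ α₂ β c ζ * ζ).re - α₂ * ζ.re| ≤ M) := by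
  set κ := Real.cos (β * Real.pi / 2) with hκ
  have hpi := Real.pi_pos
  have hκ0 : 0 < κ := Real.cos_pos_of_mem_Ioo ⟨by nlinarith, by nlinarith⟩
  -- `exp (-β y) (y + π)` is bounded for `y ≥ 0`
  have hexp : ∀ y : ℝ, 0 ≤ y → Real.exp (-(β * y)) * (y + Real.pi) ≤ 1 / β + Real.pi := by
    intro y hy
    have h1 := Real.add_one_le_exp (β * y)
    have h2 : Real.exp (-(β * y)) * Real.exp (β * y) = 1 := by rw [← Real.exp_add]; simp
    have h3 := Real.exp_pos (-(β * y))
    have h4 : Real.exp (-(β * y)) ≤ 1 := Real.exp_le_one_iff.2 (by nlinarith)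
    have h5 : Real.exp (-(β * y)) * y ≤ 1 / β := by
      rw [le_div_iff₀ hβ₀]
      calc Real.exp (-(β * y)) * y * β = Real.exp (-(β * y)) * (β * y) := by ring
        _ ≤ Real.exp (-(β * y)) * Real.exp (β * y) := by gcongr; linarith
        _ = 1 := h2
    nlinarith
  have hnorm : ∀ ζ : ℂ, |ζ.im| ≤ Real.pi → ‖ζ‖ ≤ |ζ.re| + Real.pi := fun ζ hζ =>
    (Complex.norm_le_abs_re_add_abs_im ζ).trans (by linarith)
  refine ⟨max (c / κ) (1 / (κ * c)) * (1 / β + Real.pi), fun ζ hζ => ?_⟩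
  have hlow := le_norm_powLog_add hβ₀ hβ₁ hc hζ
  rw [← hκ] at hlow
  have hne := powLog_add_ne_zero hβ₀ hc (lt_pi_div_of_le_pi hβ₀ hβ₁ hζ)
  have hw := norm_powLog_ofReal β ζ
  have he := Real.exp_pos (β * ζ.re)
  have hdpos : 0 < ‖powLog ζ β + c‖ := norm_pos_iff.2 hne
  have hreal : ‖((α₂ - α₁ : ℝ) : ℂ)‖ ≤ 1 := by rwa [Complex.norm_real]
  have hβπ : 0 < 1 / β + Real.pi := by positivity
  constructor
  · intro hx
    have h1 : mlOrder α₁ α₂ β c ζ - α₁ = ((α₂ - α₁ : ℝ) : ℂ) * (c / (powLog ζ β + c)) := by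
      rw [mlOrder_eq]
      field_simp
      push_cast
      ring
    have h2 : ‖mlOrder α₁ α₂ β c ζ - α₁‖ ≤ c / κ * Real.exp (-(β * ζ.re)) := by
      rw [h1, norm_mul, norm_div, Complex.norm_of_nonneg hc.le]
      refine (mul_le_of_le_one_left (by positivity) hreal).trans ?_
      rw [div_le_iff₀ hdpos, Real.exp_neg]
      calc c = c / κ * (Real.exp (β * ζ.re))⁻¹ * (κ * (Real.exp (β * ζ.re) + 0)) := by
            field_simp; ring
        _ ≤ c / κ * (Real.exp (β * ζ.re))⁻¹ * (κ * (Real.exp (β * ζ.re) + c)) := by gcongr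
        _ ≤ _ := by gcongr
    have h3 : (mlOrder α₁ α₂ β c ζ * ζ).re - α₁ * ζ.re
        = ((mlOrder α₁ α₂ β c ζ - α₁) * ζ).re := by
      rw [sub_mul, Complex.sub_re, Complex.re_ofReal_mul]
    rw [h3]
    calc _ ≤ ‖mlOrder α₁ α₂ β c ζ - α₁‖ * ‖ζ‖ := by
          rw [← norm_mul]; exact Complex.abs_re_le_norm _
      _ ≤ c / κ * Real.exp (-(β * ζ.re)) * (ζ.re + Real.pi) := by
          have := hnorm ζ hζ
          rw [abs_of_nonneg hx] at this
          gcongr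
      _ = c / κ * (Real.exp (-(β * ζ.re)) * (ζ.re + Real.pi)) := by ring
      _ ≤ c / κ * (1 / β + Real.pi) := by
          gcongr
          exact hexp _ hx
      _ ≤ _ := by
          gcongr
          exact le_max_left _ _
  · intro hx
    have h1 : mlOrder α₁ α₂ β c ζ - α₂
        = -(((α₂ - α₁ : ℝ) : ℂ) * (powLog ζ β / (powLog ζ β + c))) := by
      rw [mlOrder_eq]
      field_simp
      push_cast
      ring
    have h2 : ‖mlOrder α₁ α₂ β c ζ - α₂‖ ≤ 1 / (κ * c) * Real.exp (-(β * -ζ.re)) := by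
      rw [h1, norm_neg, norm_mul, norm_div, hw]
      refine (mul_le_of_le_one_left (by positivity) hreal).trans ?_
      rw [div_le_iff₀ hdpos, show -(β * -ζ.re) = β * ζ.re by ring]
      calc Real.exp (β * ζ.re) = 1 / (κ * c) * Real.exp (β * ζ.re) * (κ * (0 + c)) := by
            field_simp; ring
        _ ≤ 1 / (κ * c) * Real.exp (β * ζ.re) * (κ * (Real.exp (β * ζ.re) + c)) := by gcongr
        _ ≤ _ := by gcongr
    have h3 : (mlOrder α₁ α₂ β c ζ * ζ).re - α₂ * ζ.re
        = ((mlOrder α₁ α₂ β c ζ - α₂) * ζ).re := by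
      rw [sub_mul, Complex.sub_re, Complex.re_ofReal_mul]
    rw [h3]
    calc _ ≤ ‖mlOrder α₁ α₂ β c ζ - α₂‖ * ‖ζ‖ := by
          rw [← norm_mul]; exact Complex.abs_re_le_norm _
      _ ≤ 1 / (κ * c) * Real.exp (-(β * -ζ.re)) * (-ζ.re + Real.pi) := by
          have := hnorm ζ hζ
          rw [abs_of_nonpos hx] at this
          gcongr
      _ = 1 / (κ * c) * (Real.exp (-(β * -ζ.re)) * (-ζ.re + Real.pi)) := by ring
      _ ≤ 1 / (κ * c) * (1 / β + Real.pi) := by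
          gcongr
          exact hexp _ (by linarith)
      _ ≤ _ := by
          gcongr
          exact le_max_right _ _

theorem norm_powLog_mlOrder (α₁ α₂ β c : ℝ) (ζ : ℂ) :
    ‖powLog ζ (mlOrder α₁ α₂ β c ζ)‖ = Real.exp (mlOrder α₁ α₂ β c ζ * ζ).re := by
  rw [powLog, Complex.norm_exp]

theorem norm_kernelSymbol (α₁ α₂ β c : ℝ) (ζ : ℂ) :
    ‖kernelSymbol α₁ α₂ β c ζ‖ = Real.exp ((mlOrder α₁ α₂ β c ζ * ζ).re - ζ.re) := by
  rw [kernelSymbol_eq, norm_mul, norm_powLog_mlOrder, Complex.norm_exp, ← Real.exp_add]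
  simp [sub_eq_add_neg]

/-! ### The three symbols of the relaxation problem -/

theorem abs_log_im_lt {β : ℝ} (hβ₀ : 0 < β) (hβ₁ : β < 1) (s : ℂ) :
    |(Complex.log s).im| < Real.pi / β :=
  lt_pi_div_of_le_pi hβ₀ hβ₁ (abs_log_im_le s)

/-- Near the ends of the strip the denominator stays away from zero, and near infinity it is
comparable to `s ^ (s A(s))`. -/
theorem exists_bound_relaxDenom {α₁ α₂ β c lam : ℝ} (hα₁ : 0 < α₁) (hα₂ : 0 < α₂)
    (hlam : 0 < lam) {M : ℝ} (hM : ∀ ζ : ℂ, |ζ.im| ≤ Real.pi →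
      (0 ≤ ζ.re → |(mlOrder α₁ α₂ β c ζ * ζ).re - α₁ * ζ.re| ≤ M) ∧
      (ζ.re ≤ 0 → |(mlOrder α₁ α₂ β c ζ * ζ).re - α₂ * ζ.re| ≤ M)) :
    ∃ X : ℝ, 0 ≤ X ∧ ∀ ζ : ℂ, |ζ.im| ≤ Real.pi → X ≤ |ζ.re| →
      lam / 2 ≤ ‖relaxDenom α₁ α₂ β c lam ζ‖ ∧
      (0 ≤ ζ.re → Real.exp (mlOrder α₁ α₂ β c ζ * ζ).re / 2 ≤ ‖relaxDenom α₁ α₂ β c lam ζ‖) := by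
  set X := max 0 (max ((Real.log (2 * lam) + M) / α₁) ((M - Real.log (lam / 2)) / α₂))
  have hX0 : 0 ≤ X := le_max_left _ _
  refine ⟨X, hX0, fun ζ hζ hX => ?_⟩
  obtain ⟨h1, h2⟩ := hM ζ hζ
  have hE := norm_powLog_mlOrder α₁ α₂ β c ζ
  have hnl : ‖(lam : ℂ)‖ = lam := Complex.norm_of_nonneg hlam.le
  rw [relaxDenom_eq]
  rcases le_total 0 ζ.re with h0 | h0
  · rw [abs_of_nonneg h0] at hX
    have h3 : (Real.log (2 * lam) + M) / α₁ ≤ ζ.re :=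
      (le_max_left _ _).trans ((le_max_right _ _).trans hX)
    rw [div_le_iff₀ hα₁] at h3
    have h4 : 2 * lam ≤ Real.exp (mlOrder α₁ α₂ β c ζ * ζ).re := by
      rw [← Real.log_le_iff_le_exp (by positivity)]
      linarith [(abs_le.1 (h1 h0)).1]
    have h5 := norm_sub_le_norm_add (powLog ζ (mlOrder α₁ α₂ β c ζ)) (lam : ℂ)
    rw [hE, hnl] at h5
    exact ⟨by linarith, fun _ => by linarith⟩
  · rw [abs_of_nonpos h0] at hX
    have h3 : (M - Real.log (lam / 2)) / α₂ ≤ -ζ.re :=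
      (le_max_right _ _).trans ((le_max_right _ _).trans hX)
    rw [div_le_iff₀ hα₂] at h3
    have h4 : Real.exp (mlOrder α₁ α₂ β c ζ * ζ).re ≤ lam / 2 := by
      rw [← Real.le_log_iff_exp_le (by positivity)]
      linarith [(abs_le.1 (h2 h0)).2]
    have h5 := norm_sub_le_norm_add (lam : ℂ) (powLog ζ (mlOrder α₁ α₂ β c ζ))
    rw [hE, hnl, add_comm (lam : ℂ)] at h5
    have h6 : lam / 2 ≤ ‖powLog ζ (mlOrder α₁ α₂ β c ζ) + lam‖ := by linarith
    exact ⟨h6, fun _ => by linarith⟩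

theorem finite_relaxPoles {α₁ α₂ β c lam : ℝ} (hα₁ : 0 < α₁) (hα₂ : 0 < α₂)
    (hα : |α₂ - α₁| ≤ 1) (hβ₀ : 0 < β) (hβ₁ : β < 1) (hc : 0 < c) (hlam : 0 < lam) :
    (relaxPoles α₁ α₂ β c lam).Finite := by
  obtain ⟨M, hM⟩ := exists_bound_mlOrder hα hβ₀ hβ₁ hc
  obtain ⟨X, hX0, hX⟩ := exists_bound_relaxDenom hα₁ hα₂ hlam hM
  have hpi := Real.pi_pos
  have hne : ∀ ζ : ℂ, |ζ.im| ≤ Real.pi → X ≤ |ζ.re| → relaxDenom α₁ α₂ β c lam ζ ≠ 0 := by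
    intro ζ h1 h2 h3
    have := (hX ζ h1 h2).1
    rw [h3, norm_zero] at this
    linarith
  set Z : Set ℂ := {ζ | |ζ.im| ≤ Real.pi ∧ relaxDenom α₁ α₂ β c lam ζ = 0} with hZ
  have hZK : Z ⊆ Icc (-X) X ×ℂ Icc (-Real.pi) Real.pi := by
    rintro ζ ⟨h1, h2⟩
    refine ⟨?_, abs_le.1 h1⟩
    by_contra hcon
    exact hne ζ h1 (le_of_lt (not_le.1 fun h3 => hcon (abs_le.1 h3))) h2
  -- an accumulation point of zeros would make the denominator vanish on all of `|Im ζ| < π / β`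
  have hZfin : Z.Finite := by
    by_contra hinf
    obtain ⟨ζ₀, hζ₀, hacc⟩ := Set.Infinite.exists_accPt_of_subset_isCompact hinf
      (isCompact_Icc.reProdIm isCompact_Icc) hZK
    have hmem : ∀ ζ : ℂ, |ζ.im| ≤ Real.pi → ζ ∈ {ζ : ℂ | |ζ.im| < Real.pi / β} := fun ζ hζ =>
      lt_pi_div_of_le_pi hβ₀ hβ₁ hζ
    have hconv : Convex ℝ {ζ : ℂ | |ζ.im| < Real.pi / β} := by
      have : {ζ : ℂ | |ζ.im| < Real.pi / β}
          = Complex.imLm ⁻¹' Ioo (-(Real.pi / β)) (Real.pi / β) := by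
        ext ζ; simp [abs_lt]
      rw [this]
      exact (convex_Ioo _ _).linear_preimage Complex.imLm
    have hfreq : ∃ᶠ ζ in 𝓝[≠] ζ₀, relaxDenom α₁ α₂ β c lam ζ = 0 :=
      (accPt_iff_frequently_nhdsNE.1 hacc).mono fun ζ hζ => hζ.2
    have hz := (analyticOnNhd_relaxDenom α₁ α₂ lam hβ₀ hc
      ).eqOn_zero_of_preconnected_of_frequently_eq_zero hconv.isPreconnected
      (hmem ζ₀ (abs_le.2 hζ₀.2)) hfreq
    have hX' : |((X : ℂ)).im| ≤ Real.pi := by simp [hpi.le]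
    exact hne X hX' (by simp [abs_of_nonneg hX0]) (hz (hmem X hX'))
  refine (hZfin.image Complex.exp).subset fun s hs => ⟨Complex.log s, ⟨abs_log_im_le s, hs.2⟩,
    Complex.exp_log (Complex.slitPlane_ne_zero hs.1)⟩

theorem isStripSymbol_kernelSymbol {α₁ α₂ β c : ℝ} (hα₁ : 0 < α₁) (hα : α₁ < α₂) (hα₂ : α₂ < 1)
    (hβ₀ : 0 < β) (hβ₁ : β < 1) (hc : 0 < c) :
    IsStripSymbol (kernelSymbol α₁ α₂ β c) ∅ (α₂ - 1) := by
  obtain ⟨M, hM⟩ := exists_bound_mlOrder (α₁ := α₁) (α₂ := α₂)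
    (abs_le.2 ⟨by linarith, by linarith⟩) hβ₀ hβ₁ hc
  refine ⟨by simp, fun ζ hζ _ => differentiableAt_kernelSymbol _ _ hβ₀ hc
    (lt_pi_div_of_le_pi hβ₀ hβ₁ hζ), by simp, by linarith, by linarith, Real.exp M, 0,
    fun ζ hζ _ => ?_⟩
  rw [norm_kernelSymbol, ← Real.exp_add]
  refine Real.exp_le_exp.2 ?_
  obtain ⟨h1, h2⟩ := hM ζ hζ
  rcases le_total 0 ζ.re with h0 | h0
  · nlinarith [(abs_le.1 (h1 h0)).2]
  · linarith [(abs_le.1 (h2 h0)).2]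

section Poles

variable {α₁ α₂ β c lam : ℝ} {P : Finset ℂ}

theorem relaxDenom_ne_zero (hcut : ∀ ρ : ℝ, 0 < ρ → relaxDenom α₁ α₂ β c lam (cutLog 1 ρ) ≠ 0 ∧
      relaxDenom α₁ α₂ β c lam (cutLog (-1) ρ) ≠ 0)
    (hP : (P : Set ℂ) = relaxPoles α₁ α₂ β c lam) {ζ : ℂ} (hζ : |ζ.im| ≤ Real.pi)
    (hζP : Complex.exp ζ ∉ P) : relaxDenom α₁ α₂ β c lam ζ ≠ 0 := by
  by_cases hs : Complex.exp ζ ∈ Complex.slitPlane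
  · intro h0
    refine hζP (Finset.mem_coe.1 (hP ▸ ⟨hs, ?_⟩))
    rwa [← eq_log_of_exp_mem_slitPlane hζ hs]
  · -- `ζ` lies on one of the boundary lines
    have hend : ζ.im = Real.pi ∨ ζ.im = -Real.pi := by
      by_contra hcon
      push Not at hcon
      rw [abs_le] at hζ
      refine hs (Complex.mem_slitPlane_iff_arg.2 ⟨?_, Complex.exp_ne_zero _⟩)
      rw [← Complex.log_im, Complex.log_exp (lt_of_le_of_ne hζ.1 hcon.2.symm) hζ.2]
      exact hcon.1
    have h1 : ζ = cutLog 1 (Real.exp ζ.re) ∨ ζ = cutLog (-1) (Real.exp ζ.re) := by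
      rcases hend with h | h
      · left; apply Complex.ext <;> simp [cutLog_re, cutLog_im, h]
      · right; apply Complex.ext <;> simp [cutLog_re, cutLog_im, h]
    rcases h1 with h | h
    · rw [h]; exact (hcut _ (Real.exp_pos _)).1
    · rw [h]; exact (hcut _ (Real.exp_pos _)).2

theorem isStripSymbol_inv_relaxDenom (hα₁ : 0 < α₁) (hα : α₁ < α₂) (hα₂ : α₂ < 1)
    (hβ₀ : 0 < β) (hβ₁ : β < 1) (hc : 0 < c) (hlam : 0 < lam)
    (hcut : ∀ ρ : ℝ, 0 < ρ → relaxDenom α₁ α₂ β c lam (cutLog 1 ρ) ≠ 0 ∧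
      relaxDenom α₁ α₂ β c lam (cutLog (-1) ρ) ≠ 0)
    (hP : (P : Set ℂ) = relaxPoles α₁ α₂ β c lam) :
    IsStripSymbol (fun ζ => (relaxDenom α₁ α₂ β c lam ζ)⁻¹) P (-α₁) := by
  obtain ⟨M, hM⟩ := exists_bound_mlOrder (α₁ := α₁) (α₂ := α₂)
    (abs_le.2 ⟨by linarith, by linarith⟩) hβ₀ hβ₁ hc
  obtain ⟨X, hX0, hX⟩ := exists_bound_relaxDenom hα₁ (hα₁.trans hα) hlam hM
  refine ⟨fun s hs => ?_, fun ζ hζ hζP => ?_, fun s hs => ?_, by linarith, by linarith,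
    2 * Real.exp M + 2 / lam, X, fun ζ hζ hζX => ?_⟩
  · rw [← Finset.mem_coe, hP] at hs
    exact hs.1
  · exact (differentiableAt_relaxDenom _ _ _ hβ₀ hc (lt_pi_div_of_le_pi hβ₀ hβ₁ hζ)).inv
      (relaxDenom_ne_zero hcut hP hζ hζP)
  · rw [← Finset.mem_coe, hP] at hs
    exact (((analyticOnNhd_relaxDenom α₁ α₂ lam hβ₀ hc) _ (abs_log_im_lt hβ₀ hβ₁ s)).comp
      (analyticAt_clog hs.1)).meromorphicAt.inv
  · obtain ⟨h1, h2⟩ := hX ζ hζ hζX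
    obtain ⟨h3, h4⟩ := hM ζ hζ
    rw [norm_inv]
    have hp := Real.exp_pos (-α₁ * ζ.re)
    rcases le_total 0 ζ.re with h0 | h0
    · calc _ ≤ (Real.exp (mlOrder α₁ α₂ β c ζ * ζ).re / 2)⁻¹ := inv_anti₀ (by positivity) (h2 h0)
        _ = 2 * Real.exp (-(mlOrder α₁ α₂ β c ζ * ζ).re) := by rw [Real.exp_neg]; field_simp
        _ ≤ 2 * Real.exp (M + -α₁ * ζ.re) := by
            gcongr
            linarith [(abs_le.1 (h3 h0)).1]
        _ = 2 * Real.exp M * Real.exp (-α₁ * ζ.re) := by rw [Real.exp_add]; ring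
        _ ≤ _ := by
            gcongr
            have : 0 < 2 / lam := by positivity
            linarith
    · calc _ ≤ (lam / 2)⁻¹ := inv_anti₀ (by positivity) h1
        _ = 2 / lam * 1 := by rw [inv_div, mul_one]
        _ ≤ (2 * Real.exp M + 2 / lam) * Real.exp (-α₁ * ζ.re) := by
            refine mul_le_mul ?_ (Real.one_le_exp ?_) zero_le_one (by positivity)
            · linarith [Real.exp_pos M]
            · nlinarith

theorem isStripSymbol_relaxSymbol (hα₁ : 0 < α₁) (hα : α₁ < α₂) (hα₂ : α₂ < 1)
    (hβ₀ : 0 < β) (hβ₁ : β < 1) (hc : 0 < c) (hlam : 0 < lam)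
    (hcut : ∀ ρ : ℝ, 0 < ρ → relaxDenom α₁ α₂ β c lam (cutLog 1 ρ) ≠ 0 ∧
      relaxDenom α₁ α₂ β c lam (cutLog (-1) ρ) ≠ 0)
    (hP : (P : Set ℂ) = relaxPoles α₁ α₂ β c lam) :
    IsStripSymbol (relaxSymbol α₁ α₂ β c lam) P (α₂ - 1) := by
  have HR := isStripSymbol_inv_relaxDenom hα₁ hα hα₂ hβ₀ hβ₁ hc hlam hcut hP
  obtain ⟨M, hM⟩ := exists_bound_mlOrder (α₁ := α₁) (α₂ := α₂)
    (abs_le.2 ⟨by linarith, by linarith⟩) hβ₀ hβ₁ hc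
  obtain ⟨X, hX0, hX⟩ := exists_bound_relaxDenom hα₁ (hα₁.trans hα) hlam hM
  have heq : relaxSymbol α₁ α₂ β c lam
      = fun ζ => kernelSymbol α₁ α₂ β c ζ * (relaxDenom α₁ α₂ β c lam ζ)⁻¹ :=
    funext fun ζ => relaxSymbol_eq _ _ _ _ _ ζ
  rw [heq]
  refine ⟨HR.slit, fun ζ hζ hζP => ?_, fun s hs => ?_, by linarith, by linarith,
    2 + 2 / lam * Real.exp M, X, fun ζ hζ hζX => ?_⟩
  · exact (differentiableAt_kernelSymbol _ _ hβ₀ hc (lt_pi_div_of_le_pi hβ₀ hβ₁ hζ)).mul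
      (HR.diff ζ hζ hζP)
  · exact (((analyticOnNhd_kernelSymbol α₁ α₂ hβ₀ hc) _ (abs_log_im_lt hβ₀ hβ₁ s)).comp
      (analyticAt_clog (HR.slit s hs))).meromorphicAt.mul (HR.mero s hs)
  · obtain ⟨h1, h2⟩ := hX ζ hζ hζX
    obtain ⟨h3, h4⟩ := hM ζ hζ
    rw [norm_mul, norm_inv, norm_kernelSymbol, Real.exp_sub, div_eq_mul_inv, ← Real.exp_neg]
    rcases le_total 0 ζ.re with h0 | h0
    · calc _ ≤ Real.exp (mlOrder α₁ α₂ β c ζ * ζ).re * Real.exp (-ζ.re)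
            * (Real.exp (mlOrder α₁ α₂ β c ζ * ζ).re / 2)⁻¹ := by
            gcongr
            exact h2 h0
        _ = 2 * Real.exp (-ζ.re) := by
            have := (Real.exp_pos (mlOrder α₁ α₂ β c ζ * ζ).re).ne'
            field_simp
        _ ≤ 2 * Real.exp ((α₂ - 1) * ζ.re) := by
            gcongr
            nlinarith
        _ ≤ _ := by
            gcongr
            have : 0 < 2 / lam * Real.exp M := by positivity
            linarith
    · calc _ ≤ Real.exp (α₂ * ζ.re + M) * Real.exp (-ζ.re) * (lam / 2)⁻¹ := by
            gcongr
            linarith [(abs_le.1 (h4 h0)).2]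
        _ = 2 / lam * Real.exp M * Real.exp ((α₂ - 1) * ζ.re) := by
            rw [sub_mul, sub_eq_add_neg, Real.exp_add, Real.exp_add, one_mul, inv_div]
            ring
        _ ≤ _ := by
            gcongr
            linarith

/-- Across the cut, `s⁻¹` does not jump, so the jump of
`s ^ (s A(s) - 1) / (s ^ (s A(s)) + λ) = s⁻¹ (1 - λ / (s ^ (s A(s)) + λ))` comes from the second term
only and decays faster than `1 / ρ`. -/
theorem integrableOn_cutJump_relaxSymbol (hα₁ : 0 < α₁) (hα : α₁ < α₂) (hα₂ : α₂ < 1)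
    (hβ₀ : 0 < β) (hβ₁ : β < 1) (hc : 0 < c) (hlam : 0 < lam)
    (hcut : ∀ ρ : ℝ, 0 < ρ → relaxDenom α₁ α₂ β c lam (cutLog 1 ρ) ≠ 0 ∧
      relaxDenom α₁ α₂ β c lam (cutLog (-1) ρ) ≠ 0)
    (hP : (P : Set ℂ) = relaxPoles α₁ α₂ β c lam) :
    IntegrableOn (cutJump (relaxSymbol α₁ α₂ β c lam)) (Ioi 0) := by
  have HG := isStripSymbol_relaxSymbol hα₁ hα hα₂ hβ₀ hβ₁ hc hlam hcut hP
  have HR := isStripSymbol_inv_relaxDenom hα₁ hα hα₂ hβ₀ hβ₁ hc hlam hcut hP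
  obtain ⟨C, hC0, hC⟩ := HG.exists_bound_cutJump
  obtain ⟨D, hD0, hD⟩ := HR.exists_bound_cutJump
  have hG : ∀ (σ ρ : ℝ), (σ = 1 ∨ σ = -1) → 0 < ρ → relaxSymbol α₁ α₂ β c lam (cutLog σ ρ)
      = -(ρ : ℂ)⁻¹ * (1 - lam * (relaxDenom α₁ α₂ β c lam (cutLog σ ρ))⁻¹) := by
    intro σ ρ hσ hρ
    have hne : relaxDenom α₁ α₂ β c lam (cutLog σ ρ) ≠ 0 := by
      rcases hσ with rfl | rfl
      exacts [(hcut ρ hρ).1, (hcut ρ hρ).2]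
    have hρ' : (ρ : ℂ) ≠ 0 := by exact_mod_cast hρ.ne'
    rw [relaxSymbol_eq, kernelSymbol_eq, Complex.exp_neg, exp_cutLog hσ hρ, inv_neg]
    have h1 := relaxDenom_eq α₁ α₂ β c lam (cutLog σ ρ)
    field_simp
    linear_combination h1
  have hjump : ∀ ρ : ℝ, 0 < ρ → cutJump (relaxSymbol α₁ α₂ β c lam) ρ
      = lam * (ρ : ℂ)⁻¹ * cutJump (fun ζ => (relaxDenom α₁ α₂ β c lam ζ)⁻¹) ρ := by
    intro ρ hρ
    rw [cutJump, hG _ _ (Or.inr rfl) hρ, hG _ _ (Or.inl rfl) hρ, cutJump]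
    ring
  rw [← Ioc_union_Ioi_eq_Ioi zero_le_one]
  refine IntegrableOn.union ?_ ?_
  · refine Integrable.mono' (g := fun ρ : ℝ => C * ρ ^ (α₂ - 1))
      (((intervalIntegrable_iff_integrableOn_Ioc_of_le zero_le_one).1
        (intervalIntegral.intervalIntegrable_rpow' (by linarith))).const_mul _)
      ((HG.continuousOn_cutJump.mono Ioc_subset_Ioi_self).aestronglyMeasurable
        measurableSet_Ioc) ?_
    filter_upwards [ae_restrict_mem measurableSet_Ioc] with ρ hρ using hC ρ hρ.1
  · refine Integrable.mono' (g := fun ρ : ℝ => lam * D * ρ ^ (-α₁ - 1))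
      ((integrableOn_Ioi_rpow_of_lt (by linarith) one_pos).const_mul _)
      ((HG.continuousOn_cutJump.mono (Ioi_subset_Ioi zero_le_one)).aestronglyMeasurable
        measurableSet_Ioi) ?_
    filter_upwards [ae_restrict_mem measurableSet_Ioi] with ρ hρ
    have hρ0 : 0 < ρ := one_pos.trans hρ
    rw [hjump ρ hρ0, norm_mul, norm_mul, norm_inv, Complex.norm_of_nonneg hlam.le,
      Complex.norm_of_nonneg hρ0.le, Real.rpow_sub_one hρ0.ne']
    calc _ ≤ lam * ρ⁻¹ * (D * ρ ^ (-α₁)) := by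
          gcongr
          exact hD ρ hρ0
      _ = _ := by ring

end Poles

theorem mlOrder_conj (α₁ α₂ β c : ℝ) (ζ : ℂ) :
    mlOrder α₁ α₂ β c ((starRingEnd ℂ) ζ) = (starRingEnd ℂ) (mlOrder α₁ α₂ β c ζ) := by
  simp only [mlOrder, mlA, powLog, map_mul, map_div₀, map_add, Complex.conj_ofReal,
    ← Complex.exp_conj]

theorem kernelSymbol_conj (α₁ α₂ β c : ℝ) (ζ : ℂ) :
    kernelSymbol α₁ α₂ β c ((starRingEnd ℂ) ζ) = (starRingEnd ℂ) (kernelSymbol α₁ α₂ β c ζ) := by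
  simp only [kernelSymbol, powLog, mlOrder_conj, ← Complex.exp_conj, map_mul, map_sub, map_one]

theorem relaxDenom_conj (α₁ α₂ β c lam : ℝ) (ζ : ℂ) :
    relaxDenom α₁ α₂ β c lam ((starRingEnd ℂ) ζ)
      = (starRingEnd ℂ) (relaxDenom α₁ α₂ β c lam ζ) := by
  simp only [relaxDenom_eq, powLog, mlOrder_conj, ← Complex.exp_conj, map_mul, map_add,
    Complex.conj_ofReal]

/-! ### The Laplace transform of the order function -/

/-- The Laplace integral of `E_β(-c t ^ β)` at a real point, term by term. -/
theorem mittagLeffler_laplace_real {β c x : ℝ} (hβ : 0 < β) (hc : 0 < c) (hx : 0 < x)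
    (hcx : c < x ^ β) :
    IntegrableOn (fun t => Real.exp (-x * t) * mittagLefflerFun β (-c * t ^ β)) (Ioi 0) ∧
    ∫ t in Ioi (0 : ℝ), Real.exp (-x * t) * mittagLefflerFun β (-c * t ^ β)
      = x⁻¹ * (x ^ β / (x ^ β + c)) := by
  have hxβ : 0 < x ^ β := Real.rpow_pos_of_pos hx β
  have hk : ∀ k : ℕ, 0 < β * k + 1 := fun k => by positivity
  have hG : ∀ k : ℕ, 0 < Real.Gamma (β * k + 1) := fun k => Real.Gamma_pos_of_pos (hk k)
  have hint : ∀ k : ℕ, IntegrableOn (fun t : ℝ => t ^ (β * k) * Real.exp (-(x * t))) (Ioi 0) := by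
    intro k
    have h0 : 0 ≤ β * k := by positivity
    simpa using integrableOn_rpow_mul_exp_neg_mul_rpow (s := β * k) (by linarith) one_pos hx
  have hval : ∀ k : ℕ, ∫ t in Ioi (0 : ℝ), t ^ (β * k) * Real.exp (-(x * t))
      = x⁻¹ * ((x ^ β)⁻¹) ^ k * Real.Gamma (β * k + 1) := by
    intro k
    have := Real.integral_rpow_mul_exp_neg_mul_Ioi (hk k) hx
    rw [add_sub_cancel_right] at this
    rw [this, one_div, Real.rpow_add_one (inv_ne_zero hx.ne'), Real.rpow_mul (inv_nonneg.2 hx.le),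
      Real.rpow_natCast, Real.inv_rpow hx.le]
    ring
  set F : ℕ → ℝ → ℝ := fun k t =>
    Real.exp (-x * t) * ((-c * t ^ β) ^ k / Real.Gamma (β * k + 1)) with hF
  have hFeq : ∀ k : ℕ, ∀ t ∈ Ioi (0 : ℝ),
      F k t = (-c) ^ k / Real.Gamma (β * k + 1) * (t ^ (β * k) * Real.exp (-(x * t))) := by
    intro k t ht
    simp only [hF]
    rw [mul_pow, Real.rpow_mul (le_of_lt ht), Real.rpow_natCast, neg_mul]
    ring
  have hFint : ∀ k, IntegrableOn (F k) (Ioi 0) := fun k =>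
    IntegrableOn.congr_fun (Integrable.const_mul (hint k) ((-c) ^ k / Real.Gamma (β * k + 1)))
      (fun t ht => (hFeq k t ht).symm) measurableSet_Ioi
  have hFval : ∀ k, ∫ t in Ioi (0 : ℝ), F k t = x⁻¹ * (-c / x ^ β) ^ k := by
    intro k
    rw [setIntegral_congr_fun measurableSet_Ioi (hFeq k), integral_const_mul, hval]
    have := (hG k).ne'
    rw [div_pow, inv_pow]
    field_simp
  have hFnorm : ∀ k, ∫ t in Ioi (0 : ℝ), ‖F k t‖ = x⁻¹ * (c / x ^ β) ^ k := by
    intro k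
    have : ∀ t ∈ Ioi (0 : ℝ), ‖F k t‖
        = c ^ k / Real.Gamma (β * k + 1) * (t ^ (β * k) * Real.exp (-(x * t))) := by
      intro t ht
      rw [hFeq k t ht, norm_mul, norm_div, norm_pow, norm_neg, Real.norm_of_nonneg hc.le,
        Real.norm_of_nonneg (hG k).le, Real.norm_of_nonneg
          (mul_nonneg (Real.rpow_nonneg (le_of_lt ht) _) (Real.exp_pos _).le)]
    rw [setIntegral_congr_fun measurableSet_Ioi this, integral_const_mul, hval]
    have := (hG k).ne'
    rw [div_pow, inv_pow]
    field_simp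
  have hlt : c / x ^ β < 1 := (div_lt_one hxβ).2 hcx
  have hsum : Summable fun k => ∫ t in Ioi (0 : ℝ), ‖F k t‖ := by
    simp only [hFnorm]
    exact (summable_geometric_of_lt_one (by positivity) hlt).mul_left _
  have h1 := hasSum_integral_of_summable_integral_norm hFint hsum
  have h2 : ∀ t, ∑' k, F k t = Real.exp (-x * t) * mittagLefflerFun β (-c * t ^ β) := by
    intro t
    rw [mittagLefflerFun, ← tsum_mul_left]
  simp only [h2, hFval] at h1
  have h3 : HasSum (fun k : ℕ => x⁻¹ * (-c / x ^ β) ^ k) (x⁻¹ * (1 - -c / x ^ β)⁻¹) :=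
    (hasSum_geometric_of_abs_lt_one (by
      rw [abs_div, abs_neg, abs_of_pos hc, abs_of_pos hxβ]; exact hlt)).mul_left _
  have h4 : ∫ t in Ioi (0 : ℝ), Real.exp (-x * t) * mittagLefflerFun β (-c * t ^ β)
      = x⁻¹ * (x ^ β / (x ^ β + c)) := by
    rw [h1.unique h3]
    have : x ^ β + c ≠ 0 := by positivity
    rw [neg_div, sub_neg_eq_add, one_add_div hxβ.ne', inv_div]
  refine ⟨?_, h4⟩
  -- a non-integrable function would have integral zero
  by_contra hcon
  rw [integral_undef hcon] at h4
  exact absurd h4 (by positivity)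

/-- `𝓛[α] = A` on a right half-plane: the identity holds on the real axis and extends by
analyticity. -/
theorem hasLaplaceTransform_mlTransition (α₁ α₂ : ℝ) {β c : ℝ} (hβ₀ : 0 < β) (hβ₁ : β < 1)
    (hc : 0 < c) :
    HasLaplaceTransform (mlTransition α₁ α₂ β c) (fun s => mlA α₁ α₂ β c (Complex.log s)) := by
  set σ : ℝ := c ^ (1 / β) with hσ
  have hσ0 : 0 < σ := Real.rpow_pos_of_pos hc _
  have hσc : ∀ x : ℝ, σ < x → c < x ^ β := by
    intro x hx
    have := Real.rpow_lt_rpow hσ0.le hx hβ₀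
    rwa [hσ, ← Real.rpow_mul hc.le, one_div, inv_mul_cancel₀ hβ₀.ne', Real.rpow_one] at this
  have hsplit : ∀ x t : ℝ, Real.exp (-x * t) * mlTransition α₁ α₂ β c t
      = α₂ * Real.exp (-x * t)
        + (α₁ - α₂) * (Real.exp (-x * t) * mittagLefflerFun β (-c * t ^ β)) := by
    intro x t; rw [mlTransition]; ring
  have hreal : ∀ x : ℝ, σ < x →
      IntegrableOn (fun t => Real.exp (-x * t) * mlTransition α₁ α₂ β c t) (Ioi 0) ∧
      ∫ t in Ioi (0 : ℝ), Real.exp (-x * t) * mlTransition α₁ α₂ β c t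
        = x⁻¹ * ((α₁ * x ^ β + α₂ * c) / (x ^ β + c)) := by
    intro x hx
    have hx0 := hσ0.trans hx
    have hxβ : 0 < x ^ β := Real.rpow_pos_of_pos hx0 β
    obtain ⟨h1, h2⟩ := mittagLeffler_laplace_real hβ₀ hc hx0 (hσc x hx)
    have h3 : IntegrableOn (fun t => Real.exp (-x * t)) (Ioi 0) :=
      integrableOn_exp_mul_Ioi (by linarith) 0
    simp only [hsplit]
    refine ⟨(h3.const_mul _).add (h1.const_mul _), ?_⟩
    rw [integral_add (h3.const_mul _) (h1.const_mul _), integral_const_mul, integral_const_mul, h2,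
      integral_exp_mul_Ioi (by linarith) 0]
    have : x ^ β + c ≠ 0 := by positivity
    simp only [mul_zero, Real.exp_zero]
    field_simp
    ring
  have hcomplex : ∀ s : ℂ, σ < s.re → IntegrableOn
      (fun t : ℝ => Complex.exp (-s * t) * (mlTransition α₁ α₂ β c t : ℂ)) (Ioi 0) := by
    intro s hs
    have e : (fun t : ℝ => Complex.exp (-s * t) * (mlTransition α₁ α₂ β c t : ℂ))
        = fun t : ℝ => Complex.exp ((-s.im * t : ℝ) * Complex.I)
          * ((Real.exp (-s.re * t) * mlTransition α₁ α₂ β c t : ℝ) : ℂ) := by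
      ext t
      push_cast
      rw [← mul_assoc, ← Complex.exp_add]
      congr 2
      conv_lhs => rw [← Complex.re_add_im s]
      ring
    rw [e]
    refine ((hreal s.re hs).1.ofReal).bdd_mul (c := 1) (by fun_prop) (ae_of_all _ fun t => ?_)
    rw [Complex.norm_exp_ofReal_mul_I]
  refine ⟨σ, fun s hs => ⟨hcomplex s hs, ?_⟩⟩
  set U : Set ℂ := {s | σ < s.re} with hU
  have hUo : IsOpen U := isOpen_lt continuous_const Complex.continuous_re
  have hslit : ∀ s ∈ U, s ∈ Complex.slitPlane := fun s hs => Or.inl (hσ0.trans hs)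
  have hL : AnalyticOnNhd ℂ (laplaceIntegral (mlTransition α₁ α₂ β c)) U :=
    (differentiableOn_laplace hcomplex).analyticOnNhd hUo
  have hAeq : ∀ s ∈ U, mlA α₁ α₂ β c (Complex.log s) = s⁻¹ * mlOrder α₁ α₂ β c (Complex.log s) := by
    intro s hs
    have := Complex.slitPlane_ne_zero (hslit s hs)
    rw [mlOrder, Complex.exp_log this, inv_mul_cancel_left₀ this]
  have hA : AnalyticOnNhd ℂ (fun s => mlA α₁ α₂ β c (Complex.log s)) U := by
    refine DifferentiableOn.analyticOnNhd (DifferentiableOn.congr (fun s hs => ?_) hAeq) hUo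
    exact ((differentiableAt_inv (Complex.slitPlane_ne_zero (hslit s hs))).mul
      ((differentiableAt_mlOrder α₁ α₂ hβ₀ hc (abs_log_im_lt hβ₀ hβ₁ s)).comp s
        (Complex.differentiableAt_log (hslit s hs)))).differentiableWithinAt
  have hreq : ∀ x : ℝ, σ < x → laplaceIntegral (mlTransition α₁ α₂ β c) x
      = mlA α₁ α₂ β c (Complex.log x) := by
    intro x hx
    have hx0 := hσ0.trans hx
    rw [hAeq x (by simpa [hU] using hx), mlOrder_eq, powLog_log (by exact_mod_cast hx0.ne'),
      ← Complex.ofReal_cpow hx0.le]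
    have h1 := congrArg (fun y : ℝ => (y : ℂ)) (hreal x hx).2
    rw [← integral_complex_ofReal] at h1
    push_cast at h1
    rw [laplaceIntegral, h1]
  have hconv : IsPreconnected U := (convex_halfSpace_re_gt σ).isPreconnected
  have hfreq : ∃ᶠ z in 𝓝[≠] (((σ + 1 : ℝ)) : ℂ), laplaceIntegral (mlTransition α₁ α₂ β c) z
      = mlA α₁ α₂ β c (Complex.log z) := by
    have ht : Tendsto (fun x : ℝ => (x : ℂ)) (𝓝[>] (σ + 1)) (𝓝[≠] ((σ + 1 : ℝ) : ℂ)) := by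
      refine tendsto_nhdsWithin_iff.2 ⟨(Complex.continuous_ofReal.tendsto _).mono_left
        nhdsWithin_le_nhds, ?_⟩
      filter_upwards [self_mem_nhdsWithin] with x hx
      simpa only [mem_compl_iff, mem_singleton_iff, Complex.ofReal_inj] using ne_of_gt hx
    refine ht.frequently (Eventually.frequently ?_)
    filter_upwards [self_mem_nhdsWithin] with x hx
    exact hreq x (by have : σ + 1 < x := hx; linarith)
  exact hL.eqOn_of_preconnected_of_frequently_eq hA hconv (by simp [hU]) hfreq hs

/-! ### Convolution of weakly singular functions -/

/-- A function that is continuous on `(0, ∞)` and `O(t ^ (-a))` on every `(0, T]`,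
where `0 ≤ a < 1`. -/
structure IsWeaklySingular (f : ℝ → ℂ) (a : ℝ) : Prop where
  nonneg : 0 ≤ a
  lt_one : a < 1
  cont : ContinuousOn f (Ioi 0)
  bound : ∀ T : ℝ, ∃ C : ℝ, ∀ t : ℝ, 0 < t → t ≤ T → ‖f t‖ ≤ C * t ^ (-a)

theorem IsWeaklySingular.intervalIntegrable {f : ℝ → ℂ} {a : ℝ} (hf : IsWeaklySingular f a)
    {T : ℝ} (hT : 0 ≤ T) : IntervalIntegrable f volume 0 T := by
  obtain ⟨C, hC⟩ := hf.bound T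
  rw [intervalIntegrable_iff_integrableOn_Ioc_of_le hT]
  have h1 : IntegrableOn (fun t : ℝ => C * t ^ (-a)) (Ioc 0 T) :=
    ((intervalIntegrable_iff_integrableOn_Ioc_of_le hT).1
      (intervalIntegral.intervalIntegrable_rpow' (by linarith [hf.lt_one]))).const_mul _
  refine h1.mono' ((hf.cont.mono Ioc_subset_Ioi_self).aestronglyMeasurable measurableSet_Ioc) ?_
  filter_upwards [ae_restrict_mem measurableSet_Ioc] with t ht using hC t ht.1 ht.2

theorem integrableOn_beta {a b : ℝ} (ha : a < 1) (hb : b < 1) :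
    IntegrableOn (fun x : ℝ => x ^ (-a) * (1 - x) ^ (-b)) (Ioc 0 1) := by
  have h := (Complex.betaIntegral_convergent (u := ((1 - a : ℝ) : ℂ)) (v := ((1 - b : ℝ) : ℂ))
    (by rw [Complex.ofReal_re]; linarith) (by rw [Complex.ofReal_re]; linarith))
  rw [intervalIntegrable_iff_integrableOn_Ioc_of_le zero_le_one] at h
  refine h.re.congr ?_
  filter_upwards [ae_restrict_mem measurableSet_Ioc] with x hx
  have e1 : ((1 - a : ℝ) : ℂ) - 1 = ((-a : ℝ) : ℂ) := by push_cast; ring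
  have e2 : ((1 - b : ℝ) : ℂ) - 1 = ((-b : ℝ) : ℂ) := by push_cast; ring
  have e3 : (1 - (x : ℂ)) = ((1 - x : ℝ) : ℂ) := by push_cast; ring
  rw [e1, e2, e3, ← Complex.ofReal_cpow hx.1.le, ← Complex.ofReal_cpow (by linarith [hx.2]),
    ← Complex.ofReal_mul]
  exact Complex.ofReal_re _

namespace IsWeaklySingular

variable {f g : ℝ → ℂ} {a b : ℝ}

/-- After scaling to `[0, 1]`, the integrand of a convolution of weakly singular functions is
dominated by a Beta integrand, uniformly for `t` in a compact subset of `(0, ∞)`. -/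
theorem exists_bound_scaled (hf : IsWeaklySingular f a) (hg : IsWeaklySingular g b) {l T : ℝ}
    (hl : 0 < l) : ∃ K : ℝ, ∀ t : ℝ, l ≤ t → t ≤ T → ∀ x ∈ Ioo (0 : ℝ) 1,
      ‖f (t * x) * g (t - t * x)‖ ≤ K * (x ^ (-a) * (1 - x) ^ (-b)) := by
  obtain ⟨C, hC⟩ := hf.bound T
  obtain ⟨D, hD⟩ := hg.bound T
  refine ⟨C * l ^ (-a) * (D * l ^ (-b)), fun t hlt htT x hx => ?_⟩
  have ht : 0 < t := hl.trans_le hlt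
  have hx1 : 0 < 1 - x := by linarith [hx.2]
  have h1 := hC (t * x) (mul_pos ht hx.1) ((mul_le_of_le_one_right ht.le hx.2.le).trans htT)
  have e : t - t * x = t * (1 - x) := by ring
  have h2 := hD (t * (1 - x)) (mul_pos ht hx1)
    ((mul_le_of_le_one_right ht.le (by linarith [hx.1])).trans htT)
  have hpx := Real.rpow_pos_of_pos hx.1 (-a)
  have hpx1 := Real.rpow_pos_of_pos hx1 (-b)
  have hC0 : 0 ≤ C := nonneg_of_mul_nonneg_left ((norm_nonneg _).trans h1)
    (Real.rpow_pos_of_pos (mul_pos ht hx.1) _)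
  have hD0 : 0 ≤ D := nonneg_of_mul_nonneg_left ((norm_nonneg _).trans h2)
    (Real.rpow_pos_of_pos (mul_pos ht hx1) _)
  have h3 : t ^ (-a) ≤ l ^ (-a) :=
    Real.rpow_le_rpow_of_nonpos hl hlt (by linarith [hf.nonneg])
  have h4 : t ^ (-b) ≤ l ^ (-b) :=
    Real.rpow_le_rpow_of_nonpos hl hlt (by linarith [hg.nonneg])
  rw [Real.mul_rpow ht.le hx.1.le] at h1
  rw [Real.mul_rpow ht.le hx1.le] at h2
  rw [norm_mul, e]
  calc _ ≤ (C * (l ^ (-a) * x ^ (-a))) * (D * (l ^ (-b) * (1 - x) ^ (-b))) := by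
        refine mul_le_mul (h1.trans (by gcongr)) (h2.trans (by gcongr)) (norm_nonneg _) ?_
        have := Real.rpow_pos_of_pos hl (-a)
        positivity
    _ = _ := by ring

theorem continuousOn_scaled (hf : IsWeaklySingular f a) (hg : IsWeaklySingular g b) {t : ℝ}
    (ht : 0 < t) : ContinuousOn (fun x : ℝ => f (t * x) * g (t - t * x)) (Ioo 0 1) := by
  refine ContinuousOn.mul (hf.cont.comp (by fun_prop) fun x hx => mul_pos ht hx.1)
    (hg.cont.comp (by fun_prop) fun x hx => ?_)
  have : 0 < t * (1 - x) := mul_pos ht (by linarith [hx.2])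
  rw [mem_Ioi]
  linarith

theorem aestronglyMeasurable_scaled (hf : IsWeaklySingular f a) (hg : IsWeaklySingular g b) {t : ℝ}
    (ht : 0 < t) : AEStronglyMeasurable (fun x : ℝ => f (t * x) * g (t - t * x))
      (volume.restrict (Ioc 0 1)) := by
  rw [← restrict_Ioo_eq_restrict_Ioc]
  exact (continuousOn_scaled hf hg ht).aestronglyMeasurable measurableSet_Ioo

theorem intervalIntegrable_convolution (hf : IsWeaklySingular f a) (hg : IsWeaklySingular g b)
    {t : ℝ} (ht : 0 < t) : IntervalIntegrable (fun τ => f τ * g (t - τ)) volume 0 t := by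
  obtain ⟨K, hK⟩ := exists_bound_scaled hf hg (l := t) (T := t) ht
  have h1 : IntervalIntegrable (fun x => f (t * x) * g (t - t * x)) volume 0 1 := by
    rw [intervalIntegrable_iff_integrableOn_Ioc_of_le zero_le_one]
    refine ((integrableOn_beta hf.lt_one hg.lt_one).const_mul K).mono'
      (aestronglyMeasurable_scaled hf hg ht) ?_
    rw [← restrict_Ioo_eq_restrict_Ioc]
    filter_upwards [ae_restrict_mem measurableSet_Ioo] with x hx
    exact hK t le_rfl le_rfl x hx
  have h2 := h1.comp_mul_left (c := t⁻¹)
  simpa [mul_inv_cancel_left₀ ht.ne', ht.ne'] using h2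

theorem continuousOn_convolution (hf : IsWeaklySingular f a) (hg : IsWeaklySingular g b) :
    ContinuousOn (fun t => ∫ τ in (0 : ℝ)..t, f τ * g (t - τ)) (Ioi 0) := by
  have hscale : ∀ t ∈ Ioi (0 : ℝ), (∫ τ in (0 : ℝ)..t, f τ * g (t - τ))
      = t • ∫ x in (0 : ℝ)..1, f (t * x) * g (t - t * x) := by
    intro t _
    rw [intervalIntegral.smul_integral_comp_mul_left (fun τ => f τ * g (t - τ)) t]
    simp
  refine ContinuousOn.congr (fun t₀ ht₀ => ?_) hscale
  have ht₀' : 0 < t₀ := ht₀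
  refine (continuousAt_id.smul ?_).continuousWithinAt
  obtain ⟨K, hK⟩ := exists_bound_scaled hf hg (l := t₀ / 2) (T := 2 * t₀) (by positivity)
  have hnear : ∀ᶠ t in 𝓝 t₀, t ∈ Ioo (t₀ / 2) (2 * t₀) :=
    Ioo_mem_nhds (by linarith) (by linarith)
  have hae : ∀ᵐ x : ℝ, x ≠ 1 := by simp [ae_iff]
  refine intervalIntegral.continuousAt_of_dominated_interval
    (bound := fun x => K * (x ^ (-a) * (1 - x) ^ (-b))) ?_ ?_ ?_ ?_
  · filter_upwards [hnear] with t ht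
    rw [uIoc_of_le zero_le_one]
    exact aestronglyMeasurable_scaled hf hg (by linarith [ht.1])
  · filter_upwards [hnear] with t ht
    filter_upwards [hae] with x hx1 hx
    rw [uIoc_of_le zero_le_one] at hx
    exact hK t ht.1.le ht.2.le x ⟨hx.1, lt_of_le_of_ne hx.2 hx1⟩
  · rw [intervalIntegrable_iff_integrableOn_Ioc_of_le zero_le_one]
    exact (integrableOn_beta hf.lt_one hg.lt_one).const_mul K
  · filter_upwards [hae] with x hx1 hx
    rw [uIoc_of_le zero_le_one] at hx
    have hx2 : 0 < 1 - x := by linarith [lt_of_le_of_ne hx.2 hx1]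
    refine ContinuousAt.mul ?_ ?_
    · exact ((hf.cont.continuousAt (Ioi_mem_nhds (mul_pos ht₀' hx.1)))).comp
        (f := fun t => t * x) (by fun_prop)
    · refine ContinuousAt.comp (f := fun t => t - t * x) (hg.cont.continuousAt ?_) (by fun_prop)
      refine Ioi_mem_nhds ?_
      have : 0 < t₀ * (1 - x) := mul_pos ht₀' hx2
      linarith

end IsWeaklySingular

/-- The real part of `stripOriginal h P`, which has the same transform if `h` commutes with
conjugation. -/
def stripOriginalRe (h : ℂ → ℂ) (P : Finset ℂ) (t : ℝ) : ℝ := (stripOriginal h P t).re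

namespace IsStripSymbol

variable {h : ℂ → ℂ} {P : Finset ℂ} {p : ℝ}

theorem hasLaplaceTransform_stripOriginalRe (H : IsStripSymbol h P p)
    (hconj : ∀ ζ, h ((starRingEnd ℂ) ζ) = (starRingEnd ℂ) (h ζ)) :
    HasLaplaceTransform (stripOriginalRe h P) (fun s => h (Complex.log s)) := by
  refine H.hasComplexLaplace_stripOriginal.re ⟨0, fun s hs => ?_⟩
  rw [Complex.log_conj, hconj]
  exact (Complex.mem_slitPlane_iff_arg.1 (Or.inl hs)).1

theorem isWeaklySingular_stripOriginalRe (H : IsStripSymbol h P p) :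
    IsWeaklySingular (fun t => (stripOriginalRe h P t : ℂ)) (p + 1) := by
  refine ⟨by linarith [H.gt], by linarith [H.lt], ?_, fun T => ?_⟩
  · exact (Complex.continuous_ofReal.comp Complex.continuous_re).comp_continuousOn
      H.continuousOn_stripOriginal
  · obtain ⟨C, hC⟩ := H.exists_bound_stripOriginal T
    refine ⟨C, fun t ht htT => le_trans ?_ (hC t ht htT)⟩
    rw [Complex.norm_real]
    exact Complex.abs_re_le_norm _

end IsStripSymbol

/-! ### Relaxation equations with a resolvent -/

/-- The kernel `k` of a convolution derivative, a continuous version `φ` of it with transform `K`,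
and the resolvent `r` with transform `R`, characterized by `(φ + λ) * r = 1`. This equation is stated
for the transforms, as `K R + λ R / s = 1 / s` on a right half-plane. -/
structure IsResolvent (k φ r : ℝ → ℝ) (K R : ℂ → ℂ) (a b lam : ℝ) : Prop where
  kernel : k =ᵐ[volume.restrict (Ioi 0)] φ
  sing_kernel : IsWeaklySingular (fun t => (φ t : ℂ)) a
  sing_resolvent : IsWeaklySingular (fun t => (r t : ℂ)) b
  laplace_kernel : HasComplexLaplace (fun t => (φ t : ℂ)) K
  laplace_resolvent : HasComplexLaplace (fun t => (r t : ℂ)) R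
  rel : ∃ σ : ℝ, ∀ s : ℂ, σ < s.re → K s * R s = s⁻¹ * (1 - lam * R s)

namespace IsResolvent

variable {k φ r : ℝ → ℝ} {K R : ℂ → ℂ} {a b lam : ℝ}

theorem intervalIntegrable (H : IsResolvent k φ r K R a b lam) {T : ℝ} (hT : 0 ≤ T) :
    IntervalIntegrable r volume 0 T := by
  have h := H.sing_resolvent.intervalIntegrable hT
  rw [intervalIntegrable_iff, IntegrableOn] at h ⊢
  simpa using h.re

theorem continuousAt (H : IsResolvent k φ r K R a b lam) {t : ℝ} (ht : 0 < t) :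
    ContinuousAt r t := by
  have := Complex.continuous_re.continuousAt.comp
    (H.sing_resolvent.cont.continuousAt (Ioi_mem_nhds ht))
  simpa [Function.comp_def] using this

theorem hasDerivAt_integral (H : IsResolvent k φ r K R a b lam) {t : ℝ} (ht : 0 < t) :
    HasDerivAt (fun t => ∫ τ in (0 : ℝ)..t, r τ) (r t) t := by
  refine intervalIntegral.integral_hasDerivAt_right (H.intervalIntegrable ht.le) ?_
    (H.continuousAt ht)
  exact ContinuousOn.stronglyMeasurableAtFilter isOpen_Ioi
    (fun x hx => (H.continuousAt hx).continuousWithinAt) t ht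

theorem hasComplexLaplace_one_sub (H : IsResolvent k φ r K R a b lam) :
    HasComplexLaplace (fun t => ((1 - lam * ∫ τ in (0 : ℝ)..t, r τ : ℝ) : ℂ))
      (fun s => s⁻¹ * (1 - lam * R s)) := by
  have h := (HasComplexLaplace.one.add (H.laplace_resolvent.primitive.const_mul (-lam)))
  refine (h.congr_transform (G := fun s => s⁻¹ * (1 - lam * R s)) 0 fun s _ => by ring).congr_ae
    (Eventually.of_forall fun t => ?_)
  simp only
  rw [intervalIntegral.integral_ofReal]
  push_cast
  ring

theorem convolution_eq (H : IsResolvent k φ r K R a b lam) {t : ℝ} (ht : 0 < t) :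
    ∫ τ in (0 : ℝ)..t, φ (t - τ) * r τ = 1 - lam * ∫ τ in (0 : ℝ)..t, r τ := by
  obtain ⟨σ, hσ⟩ := H.rel
  have h1 := (H.laplace_kernel.convolution H.laplace_resolvent).congr_transform σ hσ
  have hc : ContinuousOn (fun t => ((1 - lam * ∫ τ in (0 : ℝ)..t, r τ : ℝ) : ℂ)) (Ioi 0) := by
    refine Complex.continuous_ofReal.comp_continuousOn (continuousOn_const.sub
      (continuousOn_const.mul fun x hx => ?_))
    exact (H.hasDerivAt_integral hx).continuousAt.continuousWithinAt
  have h2 := h1.eqOn H.hasComplexLaplace_one_sub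
    (IsWeaklySingular.continuousOn_convolution H.sing_kernel H.sing_resolvent) hc ht
  simp only [← Complex.ofReal_mul] at h2
  rw [intervalIntegral.integral_ofReal] at h2
  have e := intervalIntegral.integral_comp_sub_left (a := 0) (b := t) (fun τ => φ τ * r (t - τ)) t
  simp only [sub_self, sub_zero, sub_sub_cancel] at e
  rw [← Complex.ofReal_inj.1 h2, e]

theorem kernel_comp_sub (H : IsResolvent k φ r K R a b lam) (t : ℝ) :
    ∀ᵐ τ : ℝ, τ < t → k (t - τ) = φ (t - τ) := by
  have h1 := (ae_restrict_iff' measurableSet_Ioi).1 H.kernel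
  filter_upwards [(volume.measurePreserving_sub_left t).quasiMeasurePreserving.ae h1] with τ hτ hlt
  exact hτ (sub_pos.2 hlt)

theorem isScarpiRelaxationSolution {α : ℝ → ℝ} (H : IsResolvent (scarpiKernel α) φ r K R a b lam)
    (u₀ : ℝ) : IsScarpiRelaxationSolution α lam u₀
      (fun t => u₀ * (1 - lam * ∫ τ in (0 : ℝ)..t, r τ)) := by
  have hderiv : ∀ t : ℝ, 0 < t →
      deriv (fun t => u₀ * (1 - lam * ∫ τ in (0 : ℝ)..t, r τ)) t = -(lam * u₀) * r t := by
    intro t ht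
    have := (((H.hasDerivAt_integral ht).const_mul lam).const_sub 1).const_mul u₀
    rw [this.deriv]
    ring
  have hae : ∀ t : ℝ, 0 < t → (fun τ => φ (t - τ) * r τ * -(lam * u₀))
      =ᵐ[volume.restrict (uIoc 0 t)] (fun τ => scarpiKernel α (t - τ)
        * deriv (fun t => u₀ * (1 - lam * ∫ τ in (0 : ℝ)..t, r τ)) τ) := by
    intro t ht
    rw [uIoc_of_le ht.le, ← restrict_Ioo_eq_restrict_Ioc]
    filter_upwards [ae_restrict_of_ae (H.kernel_comp_sub t), ae_restrict_mem measurableSet_Ioo]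
      with τ h1 hτ
    rw [h1 hτ.2, hderiv τ hτ.1]
    ring
  refine ⟨fun T hT => ?_, by simp, fun t ht => ?_, fun t ht => ?_⟩
  · have h1 := (H.intervalIntegrable hT.le).absolutelyContinuousOnInterval_intervalIntegral
      (c := 0) (by simp)
    have h2 : AbsolutelyContinuousOnInterval (fun _ : ℝ => (1 : ℝ)) 0 T :=
      LipschitzOnWith.absolutelyContinuousOnInterval (LipschitzWith.const 1).lipschitzOnWith
    exact (h2.sub (h1.const_mul lam)).const_mul u₀
  · refine IntervalIntegrable.congr_ae (IntervalIntegrable.mul_const ?_ _) (hae t ht)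
    have h1 := (IsWeaklySingular.intervalIntegrable_convolution H.sing_resolvent H.sing_kernel ht)
    rw [intervalIntegrable_iff, IntegrableOn] at h1 ⊢
    simpa [← Complex.ofReal_mul, mul_comm] using h1.re
  · rw [scarpiDeriv, ← intervalIntegral.integral_congr_ae_restrict (hae t ht),
      intervalIntegral.integral_mul_const, H.convolution_eq ht]
    ring

/-- The derivative `h` of a solution, cut off at `T`, satisfies `φ * h + λ (u₀ + 1 * h) = 0` on
`(0, T)`. Convolution with the resolvent turns this into `1 * h + λ u₀ (1 * r) = 0` on `(0, T)`,
which determines the solution. -/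
theorem solution_unique {α : ℝ → ℝ} (H : IsResolvent (scarpiKernel α) φ r K R a b lam) {u₀ : ℝ}
    {v : ℝ → ℝ} (hv : IsScarpiRelaxationSolution α lam u₀ v) {t : ℝ} (ht : 0 ≤ t) :
    v t = u₀ * (1 - lam * ∫ τ in (0 : ℝ)..t, r τ) := by
  rcases ht.eq_or_lt with rfl | ht
  · simp [hv.initial]
  set T := t + 1 with hT
  have hT0 : 0 < T := by positivity
  set h : ℝ → ℝ := indicator (Ioo 0 T) (deriv v) with hh
  have hdint : IntegrableOn (deriv v) (Ioo 0 T) := by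
    have := (hv.absolutelyContinuous T hT0).intervalIntegrable_deriv
    rw [intervalIntegrable_iff_integrableOn_Ioo_of_le hT0.le] at this
    exact this
  have hint : Integrable h := hdint.integrable_indicator measurableSet_Ioo
  have hprim : ∀ x ∈ Ioo 0 T, v x = u₀ + ∫ τ in (0 : ℝ)..x, h τ := by
    intro x hx
    have h1 := (hv.absolutelyContinuous x hx.1).integral_deriv_eq_sub
    have h2 : ∫ τ in (0 : ℝ)..x, h τ = ∫ τ in (0 : ℝ)..x, deriv v τ := by
      refine intervalIntegral.integral_congr_uIoo fun τ hτ => ?_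
      rw [uIoo_of_le hx.1.le] at hτ
      exact indicator_of_mem (show τ ∈ Ioo 0 T from ⟨hτ.1, hτ.2.trans hx.2⟩) _
    rw [h2, h1, hv.initial]
    ring
  -- the transform of `h`
  set L : ℂ → ℂ := fun s => ∫ t in Ioi (0 : ℝ), Complex.exp (-s * t) * (h t : ℂ)
  have hL : HasComplexLaplace (fun t => (h t : ℂ)) L := by
    refine ⟨0, fun s hs => ⟨?_, rfl⟩⟩
    refine Integrable.bdd_mul (c := 1) hint.ofReal.integrableOn (by fun_prop) ?_
    filter_upwards [ae_restrict_mem measurableSet_Ioi] with x hx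
    rw [Complex.norm_exp]
    refine Real.exp_le_one_iff.2 ?_
    have : 0 < s.re * x := mul_pos hs hx
    simp only [Complex.mul_re, Complex.neg_re, Complex.ofReal_re, Complex.ofReal_im, mul_zero,
      sub_zero]
    linarith
  -- the equation, extended by `h` beyond `T`
  set D : ℝ → ℂ := fun x => (∫ τ in (0 : ℝ)..x, (φ τ : ℂ) * (h (x - τ) : ℂ))
    + lam * (u₀ * 1 + ∫ τ in (0 : ℝ)..x, (h τ : ℂ)) with hD
  have hDL : HasComplexLaplace D (fun s => K s * L s + lam * (u₀ * s⁻¹ + L s * s⁻¹)) :=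
    (H.laplace_kernel.convolution hL).add
      (((HasComplexLaplace.one.const_mul u₀).add hL.primitive).const_mul lam)
  have hD0 : ∀ x ∈ Ioo 0 T, D x = 0 := by
    intro x hx
    have h1 := hv.equation x hx.1
    have h2 : ∫ τ in (0 : ℝ)..x, φ τ * h (x - τ) = scarpiDeriv α v x := by
      have e := intervalIntegral.integral_comp_sub_left (a := 0) (b := x)
        (fun τ => φ τ * h (x - τ)) x
      simp only [sub_self, sub_zero, sub_sub_cancel] at e
      rw [scarpiDeriv, ← e]
      refine intervalIntegral.integral_congr_ae_restrict ?_
      rw [uIoc_of_le hx.1.le, ← restrict_Ioo_eq_restrict_Ioc]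
      filter_upwards [ae_restrict_of_ae (H.kernel_comp_sub x), ae_restrict_mem measurableSet_Ioo]
        with τ h3 hτ
      rw [h3 hτ.2, hh, indicator_of_mem (show τ ∈ Ioo 0 T from ⟨hτ.1, hτ.2.trans hx.2⟩)]
    simp only [hD, ← Complex.ofReal_mul]
    rw [intervalIntegral.integral_ofReal, intervalIntegral.integral_ofReal, h2, h1, hprim x hx]
    push_cast
    ring
  obtain ⟨σ, hσ⟩ := H.rel
  have h1 := (hDL.convolution H.laplace_resolvent).congr_transform
    (G := fun s => L s * s⁻¹ + (lam * u₀ : ℂ) * (R s * s⁻¹)) σ (fun s hs => by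
      linear_combination L s * hσ s hs)
  have h2 := hL.primitive.add (H.laplace_resolvent.primitive.const_mul (lam * u₀ : ℂ))
  have h3 := (ae_restrict_iff' measurableSet_Ioi).1 (h1.ae_eq h2)
  have h4 : v =ᵐ[volume.restrict (Ioo 0 T)]
      fun t => u₀ * (1 - lam * ∫ τ in (0 : ℝ)..t, r τ) := by
    rw [EventuallyEq, ae_restrict_iff' measurableSet_Ioo]
    filter_upwards [h3] with x hx hxT
    have h5 := hx hxT.1
    have h6 : ∫ τ in (0 : ℝ)..x, D τ * (r (x - τ) : ℂ) = 0 := by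
      rw [intervalIntegral.integral_congr_uIoo (g := fun _ => (0 : ℂ)) fun τ hτ => ?_]
      · simp
      · rw [uIoo_of_le hxT.1.le] at hτ
        simp only
        rw [hD0 τ ⟨hτ.1, hτ.2.trans hxT.2⟩, zero_mul]
    rw [h6, intervalIntegral.integral_ofReal, intervalIntegral.integral_ofReal] at h5
    have h7 : (0 : ℝ) = (∫ τ in (0 : ℝ)..x, h τ) + lam * u₀ * ∫ τ in (0 : ℝ)..x, r τ := by
      exact_mod_cast h5
    rw [hprim x hxT]
    linear_combination -h7
  refine Measure.eqOn_open_of_ae_eq h4 isOpen_Ioo ?_ ?_ ⟨ht, by rw [hT]; linarith⟩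
  · have := (hv.absolutelyContinuous T hT0).continuousOn
    rw [uIcc_of_le hT0.le] at this
    exact this.mono Ioo_subset_Icc_self
  · intro x hx
    exact ((((H.hasDerivAt_integral hx.1).const_mul lam).const_sub 1).const_mul
      u₀).continuousAt.continuousWithinAt

end IsResolvent

/-! ### The Scarpi relaxation problem -/

theorem exists_bound_finset (P : Finset ℂ) : ∃ B : ℝ, 0 ≤ B ∧ ∀ a ∈ P, ‖a‖ ≤ B :=
  ⟨∑ a ∈ P, ‖a‖, Finset.sum_nonneg fun a _ => norm_nonneg a, fun _ ha =>
    Finset.single_le_sum (f := fun a : ℂ => ‖a‖) (fun a _ => norm_nonneg a) ha⟩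

theorem scarpiKernel_ae_eq {α₁ α₂ β c : ℝ} (hα₁ : 0 < α₁) (hα : α₁ < α₂) (hα₂ : α₂ < 1)
    (hβ₀ : 0 < β) (hβ₁ : β < 1) (hc : 0 < c) :
    scarpiKernel (mlTransition α₁ α₂ β c) =ᵐ[volume.restrict (Ioi 0)]
      stripOriginalRe (kernelSymbol α₁ α₂ β c) ∅ := by
  have h1 := (isStripSymbol_kernelSymbol hα₁ hα hα₂ hβ₀ hβ₁ hc).hasLaplaceTransform_stripOriginalRe
    (kernelSymbol_conj α₁ α₂ β c)
  obtain ⟨σ, hσ⟩ := hasLaplaceTransform_mlTransition α₁ α₂ hβ₀ hβ₁ hc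
  have h2 : HasLaplaceTransform (stripOriginalRe (kernelSymbol α₁ α₂ β c) ∅)
      (fun s => s ^ (s * laplaceIntegral (mlTransition α₁ α₂ β c) s - 1)) := by
    refine HasComplexLaplace.congr_transform h1 (max σ 0) fun s hs => ?_
    rw [max_lt_iff] at hs
    have hs0 : s ≠ 0 := fun h => by simp [h] at hs
    rw [(hσ s hs.1).2, ← powLog_log hs0, kernelSymbol, mlOrder, Complex.exp_log hs0]
  have h3 : HasLaplaceTransform (scarpiKernel (mlTransition α₁ α₂ β c))
      (fun s => s ^ (s * laplaceIntegral (mlTransition α₁ α₂ β c) s - 1)) :=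
    Classical.epsilon_spec (p := fun f => HasLaplaceTransform f
      (fun s => s ^ (s * laplaceIntegral (mlTransition α₁ α₂ β c) s - 1))) ⟨_, h2⟩
  filter_upwards [HasComplexLaplace.ae_eq h3 h2] with t ht
  exact_mod_cast ht

section

variable {α₁ α₂ β c lam : ℝ} {P : Finset ℂ}

theorem isResolvent_scarpiKernel (hα₁ : 0 < α₁) (hα : α₁ < α₂) (hα₂ : α₂ < 1)
    (hβ₀ : 0 < β) (hβ₁ : β < 1) (hc : 0 < c) (hlam : 0 < lam)
    (hcut : ∀ ρ : ℝ, 0 < ρ → relaxDenom α₁ α₂ β c lam (cutLog 1 ρ) ≠ 0 ∧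
      relaxDenom α₁ α₂ β c lam (cutLog (-1) ρ) ≠ 0)
    (hP : (P : Set ℂ) = relaxPoles α₁ α₂ β c lam) :
    IsResolvent (scarpiKernel (mlTransition α₁ α₂ β c))
      (stripOriginalRe (kernelSymbol α₁ α₂ β c) ∅)
      (stripOriginalRe (fun ζ => (relaxDenom α₁ α₂ β c lam ζ)⁻¹) P)
      (fun s => kernelSymbol α₁ α₂ β c (Complex.log s))
      (fun s => (relaxDenom α₁ α₂ β c lam (Complex.log s))⁻¹) (α₂ - 1 + 1) (-α₁ + 1) lam := by
  have HK := isStripSymbol_kernelSymbol hα₁ hα hα₂ hβ₀ hβ₁ hc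
  have HR := isStripSymbol_inv_relaxDenom hα₁ hα hα₂ hβ₀ hβ₁ hc hlam hcut hP
  refine ⟨scarpiKernel_ae_eq hα₁ hα hα₂ hβ₀ hβ₁ hc, HK.isWeaklySingular_stripOriginalRe,
    HR.isWeaklySingular_stripOriginalRe,
    HK.hasLaplaceTransform_stripOriginalRe (kernelSymbol_conj α₁ α₂ β c),
    HR.hasLaplaceTransform_stripOriginalRe fun ζ => ?_, ?_⟩
  · rw [relaxDenom_conj, map_inv₀]
  · obtain ⟨B, hB0, hB⟩ := exists_bound_finset P
    refine ⟨B, fun s hs => ?_⟩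
    have hs0 : s ≠ 0 := fun h => by
      rw [h, Complex.zero_re] at hs
      linarith
    have hne : relaxDenom α₁ α₂ β c lam (Complex.log s) ≠ 0 := by
      refine relaxDenom_ne_zero hcut hP (abs_log_im_le s) fun hmem => ?_
      rw [Complex.exp_log hs0] at hmem
      exact absurd (hs.trans_le (Complex.re_le_norm s)) (not_lt.2 (hB s hmem))
    have h1 := relaxDenom_eq α₁ α₂ β c lam (Complex.log s)
    rw [kernelSymbol_eq, Complex.exp_neg, Complex.exp_log hs0]
    field_simp
    linear_combination -h1

/-- The solution `u₀ (1 - λ ∫₀ᵗ r)` is the inverse transform of `u₀ G`, up to `t = 0`. -/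
theorem solution_eq_stripOriginal (hα₁ : 0 < α₁) (hα : α₁ < α₂) (hα₂ : α₂ < 1)
    (hβ₀ : 0 < β) (hβ₁ : β < 1) (hc : 0 < c) (hlam : 0 < lam)
    (hcut : ∀ ρ : ℝ, 0 < ρ → relaxDenom α₁ α₂ β c lam (cutLog 1 ρ) ≠ 0 ∧
      relaxDenom α₁ α₂ β c lam (cutLog (-1) ρ) ≠ 0)
    (hP : (P : Set ℂ) = relaxPoles α₁ α₂ β c lam) :
    HasComplexLaplace (fun t => ((1 - lam * ∫ τ in (0 : ℝ)..t,
        stripOriginalRe (fun ζ => (relaxDenom α₁ α₂ β c lam ζ)⁻¹) P τ : ℝ) : ℂ))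
      (fun s => relaxSymbol α₁ α₂ β c lam (Complex.log s)) ∧
    ∀ t : ℝ, 0 ≤ t → ((1 - lam * ∫ τ in (0 : ℝ)..t,
        stripOriginalRe (fun ζ => (relaxDenom α₁ α₂ β c lam ζ)⁻¹) P τ : ℝ) : ℂ)
      = stripOriginal (relaxSymbol α₁ α₂ β c lam) P t := by
  have H := isResolvent_scarpiKernel hα₁ hα hα₂ hβ₀ hβ₁ hc hlam hcut hP
  have HG := isStripSymbol_relaxSymbol hα₁ hα hα₂ hβ₀ hβ₁ hc hlam hcut hP
  obtain ⟨σ, hσ⟩ := H.rel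
  have h1 := H.hasComplexLaplace_one_sub.congr_transform
    (G := fun s => relaxSymbol α₁ α₂ β c lam (Complex.log s)) σ
    fun s hs => by rw [relaxSymbol_eq, hσ s hs]
  refine ⟨h1, fun t ht => ?_⟩
  have hcont : ContinuousOn (fun t => ((1 - lam * ∫ τ in (0 : ℝ)..t,
      stripOriginalRe (fun ζ => (relaxDenom α₁ α₂ β c lam ζ)⁻¹) P τ : ℝ) : ℂ)) (Ici 0) := by
    refine Complex.continuous_ofReal.comp_continuousOn (continuousOn_const.sub
      (continuousOn_const.mul fun x (hx : 0 ≤ x) => ?_))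
    have hx1 : (0 : ℝ) ≤ x + 1 := by linarith
    have h2 := intervalIntegral.continuousOn_primitive_interval'
      (H.intervalIntegrable hx1) left_mem_uIcc
    rw [uIcc_of_le hx1] at h2
    refine (h2 x ⟨hx, by linarith⟩).mono_of_mem_nhdsWithin ?_
    filter_upwards [self_mem_nhdsWithin, mem_nhdsWithin_of_mem_nhds
      (Iio_mem_nhds (lt_add_one x))] with y hy1 hy2
    exact ⟨hy1, le_of_lt hy2⟩
  have hcont' := HG.continuousOn_Ici_stripOriginal
    (integrableOn_cutJump_relaxSymbol hα₁ hα hα₂ hβ₀ hβ₁ hc hlam hcut hP)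
  have h3 := h1.eqOn HG.hasComplexLaplace_stripOriginal (hcont.mono Ioi_subset_Ici_self)
    (hcont'.mono Ioi_subset_Ici_self)
  exact h3.of_subset_closure hcont hcont' Ioi_subset_Ici_self (by rw [closure_Ioi]) ht

end

theorem cutIntegrand_eq (α₁ α₂ β c lam t ρ : ℝ) : cutIntegrand α₁ α₂ β c lam t ρ
    = -(cutJump (relaxSymbol α₁ α₂ β c lam) ρ * Complex.exp (-ρ * t)) := by
  rw [cutIntegrand, cutJump]
  ring

end

theorem mainTheorem3 (α₁ α₂ β c lam u₀ : ℝ)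
    (hα₁ : 0 < α₁) (hα : α₁ < α₂) (hα₂ : α₂ < 1) (hβ₀ : 0 < β) (hβ₁ : β < 1)
    (hc : 0 < c) (hlam : 0 < lam)
    (hcut : ∀ ρ : ℝ, 0 < ρ → relaxDenom α₁ α₂ β c lam (cutLog 1 ρ) ≠ 0 ∧
      relaxDenom α₁ α₂ β c lam (cutLog (-1) ρ) ≠ 0) :
    HasLaplaceTransform (mlTransition α₁ α₂ β c) (fun s => mlA α₁ α₂ β c (Complex.log s)) ∧
    (relaxPoles α₁ α₂ β c lam).Finite ∧
    ∃ u : ℝ → ℝ,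
      IsScarpiRelaxationSolution (mlTransition α₁ α₂ β c) lam u₀ u ∧
      (∀ v : ℝ → ℝ, IsScarpiRelaxationSolution (mlTransition α₁ α₂ β c) lam u₀ v →
        ∀ t : ℝ, 0 ≤ t → v t = u t) ∧
      HasLaplaceTransform u
        (fun s => relaxSymbol α₁ α₂ β c lam (Complex.log s) * u₀) ∧
      (∀ t : ℝ, 0 ≤ t → IntegrableOn (cutIntegrand α₁ α₂ β c lam t) (Ioi 0)) ∧
      ∀ s₀ : ℝ, 0 < s₀ → (∀ z ∈ relaxPoles α₁ α₂ β c lam, z.re < s₀) →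
        ∃ R₀ > 0, ∃ ε₀ > 0, ∀ R ≥ R₀, ∀ ε : ℝ, 0 < ε → ε ≤ ε₀ → ∀ t : ℝ, 0 ≤ t →
          (u t : ℂ) = u₀ / (2 * Real.pi * Complex.I) *
            (residueTerm α₁ α₂ β c lam s₀ R ε t -
              ∫ ρ in Ioi (0 : ℝ), cutIntegrand α₁ α₂ β c lam t ρ) := by
  have hfin : (relaxPoles α₁ α₂ β c lam).Finite := finite_relaxPoles hα₁ (hα₁.trans hα)
    (abs_le.2 ⟨by linarith, by linarith⟩) hβ₀ hβ₁ hc hlam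
  set P := hfin.toFinset
  have hP : (P : Set ℂ) = relaxPoles α₁ α₂ β c lam := hfin.coe_toFinset
  have H := isResolvent_scarpiKernel hα₁ hα hα₂ hβ₀ hβ₁ hc hlam hcut hP
  have HG := isStripSymbol_relaxSymbol hα₁ hα hα₂ hβ₀ hβ₁ hc hlam hcut hP
  obtain ⟨hlap, hform⟩ := solution_eq_stripOriginal hα₁ hα hα₂ hβ₀ hβ₁ hc hlam hcut hP
  have hcutint := integrableOn_cutJump_relaxSymbol hα₁ hα hα₂ hβ₀ hβ₁ hc hlam hcut hP
  refine ⟨hasLaplaceTransform_mlTransition α₁ α₂ hβ₀ hβ₁ hc, hfin, _,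
    H.isScarpiRelaxationSolution u₀, fun v hv t ht => H.solution_unique hv ht, ?_, fun t ht => ?_,
    fun s₀ _ hs₀ => ?_⟩
  · have h1 := (hlap.const_mul u₀).congr_transform
      (G := fun s => relaxSymbol α₁ α₂ β c lam (Complex.log s) * u₀) 0 (fun s _ => mul_comm _ _)
    refine HasComplexLaplace.congr_ae h1 (Eventually.of_forall fun t => ?_)
    simp only
    rw [← Complex.ofReal_mul]
  · rw [IntegrableOn, funext (cutIntegrand_eq α₁ α₂ β c lam t)]
    refine (Integrable.mul_bdd (c := 1) hcutint (by fun_prop) ?_).neg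
    filter_upwards [ae_restrict_mem measurableSet_Ioi] with ρ hρ
    have h0 : 0 ≤ ρ * t := mul_nonneg (le_of_lt hρ) ht
    rw [Complex.norm_exp, show (-(ρ : ℂ) * (t : ℂ)).re = -(ρ * t) by simp]
    exact Real.exp_le_one_iff.2 (by linarith)
  · -- for `R` large and `ε` small all poles are inside the contour
    obtain ⟨B, hB0, hB⟩ := exists_bound_finset P
    obtain ⟨ε₀, hε, hε₀⟩ : ∃ ε : ℝ, (∀ a ∈ P, ε < ‖a‖) ∧ 0 < ε := by
      have h1 : ∀ᶠ ε in 𝓝[>] (0 : ℝ), ∀ a ∈ P, ε < ‖a‖ :=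
        (Finset.eventually_all P).2 fun a ha => (eventually_lt_nhds (norm_pos_iff.2
          (Complex.slitPlane_ne_zero (HG.slit a ha)))).filter_mono nhdsWithin_le_nhds
      exact (h1.and self_mem_nhdsWithin).exists
    refine ⟨B + 1, by linarith, ε₀, hε₀, fun R hR ε _ hεε t ht => ?_⟩
    have hinter : relaxPoles α₁ α₂ β c lam ∩ contourInterior s₀ R ε = (P : Set ℂ) := by
      rw [hP, inter_eq_left]
      intro a ha
      have haP : a ∈ P := by rwa [← Finset.mem_coe, hP]
      have haB := hB a haP
      exact ⟨ha.1, hεε.trans_lt (hε a haP), fun _ => by linarith,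
        fun _ => ⟨hs₀ a ha, (Complex.abs_im_le_norm a).trans_lt (by linarith)⟩⟩
    have hpi : (2 * Real.pi * Complex.I : ℂ) ≠ 0 := by simp [Real.pi_ne_zero]
    rw [Complex.ofReal_mul, hform t ht, residueTerm, hinter, finsum_mem_coe_finset, stripOriginal]
    simp only [cutIntegrand_eq]
    rw [integral_neg]
    generalize (∑ a ∈ P, cresidue
      (fun s => relaxSymbol α₁ α₂ β c lam (Complex.log s) * Complex.exp (s * t)) a) = S
    generalize (∫ ρ in Ioi (0 : ℝ),
      cutJump (relaxSymbol α₁ α₂ β c lam) ρ * Complex.exp (-ρ * t)) = J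
    field_simp
    ring
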